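/- Let $\mathbf{Top}$ be the category of compactly generated weak Hausdorff spaces, which is cartesian closed; write $\times$ for its product and $\mathrm{Map}$ for its internal hom. It carries the Quillen model structure, whose weak equivalences are the weak homotopy equivalences and whose fibrations are the Serre fibrations. A topological category is a category enriched in $\mathbf{Top}$; functors and natural transformations between topological categories are understood to be enriched, and $\mathrm{Fun}(\mathcal C,\mathcal N)$ is the category of functors $\mathcal C\to\mathcal N$. A topological model category is a topological category $\mathcal N$ that has all tensors and cotensors by spaces and all small conical (enriched) limits and colimits, together with a model structure on its underlying category such that for every cofibration $i\colon M\to M'$ and every fibration $p\colon L\to L'$ the map $$\mathcal N(M',L)\to \mathcal N(M',L')\times_{\mathcal N(M,L')}\mathcal N(M,L)$$ is a Serre fibration, which is moreover a weak homotopy equivalence if $i$ or $p$ is a weak equivalence. The projective model structure on $\mathrm{Fun}(\mathcal C,\mathcal N)$, if it exists, is the model structure whose fibrations and weak equivalences are the pointwise ones; $F\colon\mathcal C\to\mathcal N$ is projectively cofibrant if it is cofibrant in it. A topological model category $\mathcal N$ is good if (a) for every small topological category $\mathcal C$ the projective model structure on $\mathrm{Fun}(\mathcal C,\mathcal N)$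 exists, and (b) for every functor $\alpha\colon\mathcal C\to\mathcal D$ of small topological categories that is bijective on objects and for which all maps $\mathcal C(c,c')\to\mathcal D(\alpha(c),\alpha(c'))$ are weak homotopy equivalences, the precomposition functor $\alpha^*\colon\mathrm{Fun}(\mathcal D,\mathcal N)\to\mathrm{Fun}(\mathcal C,\mathcal N)$ is a right Quillen equivalence for the projective model structures. For functors $G\colon\mathcal C^{op}\to\mathbf{Top}$ and $F\colon\mathcal C\to\mathcal N$ with $\mathcal C$ small, the coend $\int^{\mathcal C}G\otimes F$ is the coequalizer $$\int^{\mathcal C}G\otimes F=\mathrm{coeq}\Big(\coprod_{c,c'}\mathcal C(c,c')\otimes\big(G(c')\otimes F(c)\big)\rightrightarrows\coprod_{c}G(c)\otimes F(c)\Big)$$ of the two maps given by the action of $\mathcal C$ on $G$ and on $F$. **Proposition.** Let $\mathcal N$ be a good topological model category and $\mathcal C$ a small topological category. 1. If $F\colon\mathcal C\to\mathcal N$ is projectively cofibrant and $G\to G'$ is a natural transformation of functors $\mathcal C^{op}\to\mathbf{Top}$ that is a pointwise weak homotopy equivalence, then the induced map $\int^{\mathcal C}G\otimes F\to\int^{\mathcal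 C}G'\otimes F$ is a weak equivalence in $\mathcal N$. 2. If $G\colon\mathcal C^{op}\to\mathbf{Top}$ is any functor and $F\to F'$ is a pointwise weak equivalence between projectively cofibrant functors $\mathcal C\to\mathcal N$, then the induced map $\int^{\mathcal C}G\otimes F\to\int^{\mathcal C}G\otimes F'$ is a weak equivalence in $\mathcal N$. -/

import Mathlib

open CategoryTheory MonoidalCategory Limits HomotopicalAlgebra
open scoped Topology

universe u v w

noncomputable section

/-! ### Compactly generated weak Hausdorff spaces -/

/-- A space is weakly Hausdorff if the image of every continuous map from a compact Hausdorff
space is closed. -/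
class WeaklyHausdorffSpace (X : Type u) [TopologicalSpace X] : Prop where
  isClosed_range (K : Type u) [TopologicalSpace K] [CompactSpace K] [T2Space K] (f : C(K, X)) :
    IsClosed (Set.range f)

section

variable {X : Type u} [TopologicalSpace X]

theorem WeaklyHausdorffSpace.isClosed_image [WeaklyHausdorffSpace X] {K : Type u}
    [TopologicalSpace K] [CompactSpace K] [T2Space K] (f : C(K, X)) {S : Set K}
    (hS : IsClosed S) : IsClosed (f '' S) := by
  have : CompactSpace S := isCompact_iff_compactSpace.1 hS.isCompact
  have h := WeaklyHausdorffSpace.isClosed_range S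
    (f.comp ⟨((↑) : S → K), continuous_subtype_val⟩)
  convert h using 1
  ext x
  constructor
  · rintro ⟨s, hs, rfl⟩
    exact ⟨⟨s, hs⟩, rfl⟩
  · rintro ⟨s, rfl⟩
    exact ⟨s.1, s.2, rfl⟩

theorem WeaklyHausdorffSpace.isClosed_setOf_eq_self [WeaklyHausdorffSpace X] {K : Type u}
    [TopologicalSpace K] [CompactSpace K] [T2Space K] (f : C(K, X)) :
    IsClosed {p : K × K | f p.1 = f p.2} := by
  rw [← isOpen_compl_iff, isOpen_iff_forall_mem_open]
  rintro ⟨k, l⟩ hkl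
  have hfib : ∀ a : K, IsClosed (f ⁻¹' {f a}) := by
    intro a
    have h := isClosed_image f (S := {a}) isClosed_singleton
    rw [Set.image_singleton] at h
    exact h.preimage f.continuous
  have hdisj : Disjoint (f ⁻¹' {f k}) (f ⁻¹' {f l}) := by
    rw [Set.disjoint_left]
    intro a ha hb
    exact hkl ((show f a = f k from ha).symm.trans hb)
  obtain ⟨U, V, hU, hV, hkU, hlV, hUV⟩ := normal_separation (hfib k) (hfib l) hdisj
  have hopen : ∀ W : Set K, IsOpen W → IsOpen (f ⁻¹' (f '' Wᶜ))ᶜ := fun W hW =>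
    ((isClosed_image f hW.isClosed_compl).preimage f.continuous).isOpen_compl
  have hsub : ∀ W : Set K, (f ⁻¹' (f '' Wᶜ))ᶜ ⊆ W := by
    intro W a ha
    by_contra h
    exact ha ⟨a, h, rfl⟩
  refine ⟨(f ⁻¹' (f '' Uᶜ))ᶜ ×ˢ (f ⁻¹' (f '' Vᶜ))ᶜ, ?_, (hopen U hU).prod (hopen V hV), ?_, ?_⟩
  · rintro ⟨a, b⟩ ⟨ha, hb⟩ hab
    have haV : a ∈ V := by
      by_contra h
      exact hb ⟨a, h, hab⟩
    exact Set.disjoint_left.1 hUV (hsub U ha) haV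
  · rintro ⟨a, ha, hak⟩
    exact ha (hkU hak)
  · rintro ⟨a, ha, hak⟩
    exact ha (hlV hak)

theorem WeaklyHausdorffSpace.isClosed_setOf_eq [WeaklyHausdorffSpace X] {K L : Type u}
    [TopologicalSpace K] [CompactSpace K] [T2Space K] [TopologicalSpace L] [CompactSpace L]
    [T2Space L] (f : C(K, X)) (g : C(L, X)) : IsClosed {p : K × L | f p.1 = g p.2} := by
  have h := isClosed_setOf_eq_self (⟨Sum.elim f g, by fun_prop⟩ : C(K ⊕ L, X))
  exact h.preimage (f := fun p : K × L => ((Sum.inl p.1, Sum.inr p.2) : (K ⊕ L) × (K ⊕ L)))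
    (by fun_prop)

end

/-- The set `X` equipped with the compactly generated topology associated with that of `X`. -/
@[ext]
structure KSpace (X : Type u) : Type u where
  val : X

namespace KSpace

variable {X : Type u} [TopologicalSpace X]

instance : TopologicalSpace (KSpace X) :=
  (TopologicalSpace.compactlyGenerated.{u} X).coinduced mk

theorem continuous_of_compHaus {Y : Type*} [TopologicalSpace Y] {f : KSpace X → Y}
    (h : ∀ (K : CompHaus.{u}) (g : C(K, X)), Continuous fun k => f (mk (g k))) : Continuous f :=
  continuous_coinduced_dom.2 (continuous_from_compactlyGenerated _ h)

theorem continuous_val : Continuous (val : KSpace X → X) :=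
  continuous_of_compHaus fun _ g => g.continuous

theorem continuous_mk_comp_of_compHaus (K : CompHaus.{u}) (f : C(K, X)) :
    Continuous (fun k => mk (f k)) := by
  let e : (Σ (i : (S : CompHaus.{u}) × C(S, X)), i.fst) → X := fun p => p.1.2 p.2
  have h : Continuous[inferInstance, TopologicalSpace.compactlyGenerated.{u} X] e :=
    continuous_coinduced_rng
  have h₁ : Continuous fun k : K =>
      (⟨⟨K, f⟩, k⟩ : Σ (i : (S : CompHaus.{u}) × C(S, X)), i.fst) :=
    continuous_sigmaMk (σ := fun i : (S : CompHaus.{u}) × C(S, X) => i.fst) (i := ⟨K, f⟩)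
  have h₂ : Continuous[TopologicalSpace.compactlyGenerated.{u} X, inferInstance]
      (mk : X → KSpace X) := continuous_coinduced_rng
  have h₃ := @Continuous.comp _ _ _ _ (TopologicalSpace.compactlyGenerated.{u} X) _ e mk h₂ h
  exact h₃.comp h₁

instance : CompactlyGeneratedSpace (KSpace X) :=
  uCompactlyGeneratedSpace_of_continuous_maps fun _ h =>
    continuous_of_compHaus fun K g => h K ⟨_, continuous_mk_comp_of_compHaus K g⟩

/-- A continuous map from a compactly generated space to `X` is continuous to `KSpace X`. -/
theorem continuous_mk_comp {Y : Type u} [TopologicalSpace Y] [CompactlyGeneratedSpace Y]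
    {f : Y → X} (hf : Continuous f) : Continuous (fun y => mk (f y)) :=
  continuous_from_uCompactlyGeneratedSpace _ fun K g =>
    continuous_mk_comp_of_compHaus K ⟨f ∘ g, hf.comp g.continuous⟩

/-- If continuous maps from `X` to weakly Hausdorff spaces separate points, then the compactly
generated space associated with `X` is weakly Hausdorff. -/
theorem weaklyHausdorffSpace
    (hX : ∀ x y : X, (∀ (Z : Type u) [TopologicalSpace Z] [WeaklyHausdorffSpace Z] (q : C(X, Z)),
      q x = q y) → x = y) : WeaklyHausdorffSpace (KSpace X) where
  isClosed_range K _ _ _ f := by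
    refine UCompactlyGeneratedSpace.isClosed.{u} fun L g => ?_
    let r : C(KSpace X, X) := ⟨val, continuous_val⟩
    have hE : IsClosed (⋂ (Z : Type u) (_ : TopologicalSpace Z) (_ : WeaklyHausdorffSpace Z)
        (q : C(X, Z)), {p : K × L | q (r (f p.1)) = q (r (g p.2))}) :=
      isClosed_iInter fun Z => isClosed_iInter fun _ => isClosed_iInter fun _ =>
        isClosed_iInter fun q => WeaklyHausdorffSpace.isClosed_setOf_eq
          (q.comp (r.comp f)) (q.comp (r.comp g))
    have him := (hE.isCompact.image continuous_snd).isClosed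
    convert him using 1
    ext l
    simp only [Set.mem_preimage, Set.mem_range, Set.mem_image, Set.mem_iInter, Set.mem_ofPred_eq,
      Prod.exists, exists_eq_right]
    exact ⟨fun ⟨k, hk⟩ => ⟨k, fun _ _ _ q => congrArg (fun x => q (r x)) hk⟩,
      fun ⟨k, hk⟩ => ⟨k, KSpace.ext (hX _ _ fun Z _ _ q => hk Z _ inferInstance q)⟩⟩

end KSpace

/-- The type of compactly generated weak Hausdorff spaces. -/
structure CGWH : Type (u + 1) where
  carrier : Type u
  [topologicalSpace : TopologicalSpace carrier]
  [compactlyGenerated : CompactlyGeneratedSpace carrier]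
  [weaklyHausdorff : WeaklyHausdorffSpace carrier]

namespace CGWH

attribute [instance] topologicalSpace compactlyGenerated weaklyHausdorff

instance : CoeSort CGWH.{u} (Type u) := ⟨carrier⟩

/-- Morphisms are continuous maps. -/
@[ext]
structure Hom (X Y : CGWH.{u}) : Type u where
  hom : C(X, Y)

instance : Category CGWH.{u} where
  Hom X Y := Hom X Y
  id X := ⟨ContinuousMap.id X⟩
  comp f g := ⟨g.hom.comp f.hom⟩

instance : ConcreteCategory CGWH.{u} (fun X Y => C(X, Y)) where
  hom f := f.hom
  ofHom f := ⟨f⟩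

/-- The morphism given by a continuous map. -/
abbrev ofHom {X Y : CGWH.{u}} (f : C(X, Y)) : X ⟶ Y := ⟨f⟩

@[ext]
theorem hom_ext {X Y : CGWH.{u}} {f g : X ⟶ Y} (h : ∀ x, f x = g x) : f = g :=
  ConcreteCategory.hom_ext _ _ h

theorem continuous_hom {X Y : CGWH.{u}} (f : X ⟶ Y) : Continuous f :=
  (ConcreteCategory.hom f).continuous

/-! ### The cartesian closed structure -/

instance : WeaklyHausdorffSpace PUnit.{u + 1} := ⟨fun _ _ _ _ _ => (Set.toFinite _).isClosed⟩

/-- The one-point space. -/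
abbrev point : CGWH.{u} := ⟨PUnit⟩

/-- The product in `CGWH`: the set `X × Y` with the compactly generated topology associated with
the product topology. -/
abbrev prod (X Y : CGWH.{u}) : CGWH.{u} where
  carrier := KSpace (X × Y)
  weaklyHausdorff := KSpace.weaklyHausdorffSpace fun _ _ h =>
    Prod.ext (h X ⟨_, continuous_fst⟩) (h Y ⟨_, continuous_snd⟩)

/-- The first projection. -/
abbrev prodFst (X Y : CGWH.{u}) : prod X Y ⟶ X :=
  ofHom ⟨fun p => p.val.1, continuous_fst.comp KSpace.continuous_val⟩

/-- The second projection. -/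
abbrev prodSnd (X Y : CGWH.{u}) : prod X Y ⟶ Y :=
  ofHom ⟨fun p => p.val.2, continuous_snd.comp KSpace.continuous_val⟩

/-- The morphism to the product with given components. -/
abbrev prodLift {T X Y : CGWH.{u}} (f : T ⟶ X) (g : T ⟶ Y) : T ⟶ prod X Y :=
  ofHom ⟨fun t => KSpace.mk (f t, g t),
    KSpace.continuous_mk_comp ((continuous_hom f).prodMk (continuous_hom g))⟩

instance : CartesianMonoidalCategory CGWH.{u} :=
  .ofChosenFiniteProducts
    ⟨asEmptyCone point, IsTerminal.ofUniqueHom (fun _ => ofHom ⟨fun _ => PUnit.unit, continuous_const⟩)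
      (fun _ _ => rfl)⟩
    (fun X Y => ⟨BinaryFan.mk (prodFst X Y) (prodSnd X Y),
      BinaryFan.IsLimit.mk _ (fun f g => prodLift f g) (fun _ _ => rfl) (fun _ _ => rfl)
        (fun f g m hf hg => by subst hf hg; rfl)⟩)

instance : BraidedCategory CGWH.{u} := .ofCartesianMonoidalCategory

/-- The point `(x, y)` of the product. -/
def pair {X Y : CGWH.{u}} (x : X) (y : Y) : (X ⊗ Y : CGWH.{u}) := KSpace.mk (x, y)


theorem pair_surjective {X Y : CGWH.{u}} (p : (X ⊗ Y : CGWH.{u})) :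
    ∃ x y, p = pair x y := ⟨(KSpace.val p).1, (KSpace.val p).2, rfl⟩
variable {X X' Y Y' Z : CGWH.{u}}
@[simp] theorem tensorHom_pair (f : X ⟶ X') (g : Y ⟶ Y') (x : X) (y : Y) :
  (f ⊗ₘ g) (pair x y) = pair (f x) (g y) := rfl
@[simp] theorem whiskerLeft_pair (X : CGWH.{u}) (g : Y ⟶ Y') (x : X) (y : Y) :
  (X ◁ g) (pair x y) = pair x (g y) := rfl
@[simp] theorem whiskerRight_pair (f : X ⟶ X') (Y : CGWH.{u}) (x : X) (y : Y) :
  (f ▷ Y) (pair x y) = pair (f x) y := rfl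
@[simp] theorem associator_hom_pair (x : X) (y : Y) (z : Z) :
  (α_ X Y Z).hom (pair (pair x y) z) = pair x (pair y z) := rfl
@[simp] theorem associator_inv_pair (x : X) (y : Y) (z : Z) :
  (α_ X Y Z).inv (pair x (pair y z)) = pair (pair x y) z := rfl
@[simp] theorem leftUnitor_inv_apply (x : X)  :
  (λ_ X).inv x = pair PUnit.unit x := rfl
@[simp] theorem leftUnitor_hom_pair (x : X) (a : 𝟙_ CGWH.{u}) :
  (λ_ X).hom (pair a x) = x := rfl
@[simp] theorem rightUnitor_inv_apply (x : X)  :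
  (ρ_ X).inv x = pair x PUnit.unit := rfl
@[simp] theorem braiding_hom_pair (x : X) (y : Y) :
  (β_ X Y).hom (pair x y) = pair y x := rfl

/-- Precomposition of a continuous map `X → Y` with a continuous map `K → X`. -/
def precomp {X Y : CGWH.{u}} {K : CompHaus.{u}} (t : C(K, X)) (f : Hom X Y) : C(K, Y) :=
  f.hom.comp t

/-- The coarsest topology on the set of continuous maps `X → Y` for which precomposition
with every continuous map `K → X` from a compact Hausdorff space `K` is continuous for the
compact-open topology on `C(K, Y)`. -/
instance (X Y : CGWH.{u}) : TopologicalSpace (Hom X Y) :=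
  ⨅ (K : CompHaus.{u}) (t : C(K, X)), .induced (precomp t) inferInstance

theorem continuous_toHom_iff {X Y : CGWH.{u}} {A : Type*} [TopologicalSpace A] {φ : A → Hom X Y} :
    Continuous φ ↔ ∀ (K : CompHaus.{u}) (t : C(K, X)), Continuous fun a => precomp t (φ a) := by
  simp only [continuous_iInf_rng, continuous_induced_rng]
  rfl

/-- Evaluation at a point. -/
def Hom.eval {X Y : CGWH.{u}} (x : X) : C(Hom X Y, Y) where
  toFun f := f.hom x
  continuous_toFun := by
    have h := (continuous_toHom_iff (X := X) (Y := Y)).1 continuous_id (CompHaus.of PUnit.{u + 1})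
      (ContinuousMap.const _ x)
    exact (ContinuousEvalConst.continuous_eval_const PUnit.unit).comp h

/-- The internal hom in `CGWH`: the set of continuous maps with the compactly generated topology
associated with the topology above. -/
abbrev mapsObj (X Y : CGWH.{u}) : CGWH.{u} where
  carrier := KSpace (Hom X Y)
  weaklyHausdorff := KSpace.weaklyHausdorffSpace fun _ _ h =>
    hom_ext fun x => h Y (Hom.eval x)

theorem continuous_diag_of_continuous {K Y : Type*} [TopologicalSpace K] [CompactSpace K]
    [T2Space K] [TopologicalSpace Y] (f : K → C(K, Y)) (hf : Continuous f) :
    Continuous fun k => f k k :=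
  (ContinuousMap.continuous_uncurry_of_continuous ⟨f, hf⟩).comp
    (continuous_id.prodMk continuous_id)

theorem compactlyGeneratedSpace_prod (K L : Type u) [TopologicalSpace K] [CompactSpace K]
    [T2Space K] [TopologicalSpace L] [CompactSpace L] [T2Space L] :
    CompactlyGeneratedSpace (K × L) := inferInstance

theorem continuous_uncurry_iff {X Y Z : CGWH.{u}} (f : Z → Hom X Y) :
    Continuous (fun z => KSpace.mk (f z)) ↔
      Continuous (fun p : KSpace (X × Z) => (f p.val.2).hom p.val.1) := by
  constructor
  · intro h
    refine KSpace.continuous_of_compHaus fun K g => ?_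
    have h1 := continuous_toHom_iff.1 (KSpace.continuous_val.comp (h.comp
      (continuous_snd.comp g.continuous))) K ⟨_, continuous_fst.comp g.continuous⟩
    exact continuous_diag_of_continuous _ h1
  · intro h
    refine KSpace.continuous_mk_comp ?_
    refine continuous_from_uCompactlyGeneratedSpace _ fun L g => ?_
    refine continuous_toHom_iff.2 fun K t => ?_
    refine (ContinuousMap.curry ⟨fun p : L × K => (f (g p.1)).hom (t p.2), ?_⟩).continuous
    have : CompactlyGeneratedSpace (L × K) := compactlyGeneratedSpace_prod L K
    exact h.comp (KSpace.continuous_mk_comp (X := X × Z)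
      (f := fun p : L × K => (t p.2, g p.1)) (by fun_prop))

/-- Currying. -/
def curryEquiv (X Y Z : CGWH.{u}) : (X ⊗ Z ⟶ Y) ≃ (Z ⟶ mapsObj X Y) where
  toFun h := ofHom ⟨fun z => KSpace.mk (ofHom ⟨fun x => h (KSpace.mk (x, z)), (continuous_hom h).comp
    (KSpace.continuous_mk_comp (X := X × Z) (f := fun x : X => (x, z)) (by fun_prop))⟩),
      (continuous_uncurry_iff _).2 (continuous_hom h)⟩
  invFun h := ofHom ⟨fun p => (h (KSpace.val p).2).val.hom (KSpace.val p).1,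
    (continuous_uncurry_iff (fun z => (h z).val)).1 (continuous_hom h)⟩
  left_inv _ := rfl
  right_inv _ := rfl

/-- The functoriality of the internal hom in the second variable. -/
abbrev mapsFunctor (X : CGWH.{u}) : CGWH.{u} ⥤ CGWH.{u} where
  obj := mapsObj X
  map {Y Y'} g := curryEquiv X Y' (mapsObj X Y) ((curryEquiv X Y _).symm (𝟙 _) ≫ g)
  map_id _ := rfl
  map_comp _ _ := rfl

instance : MonoidalClosed CGWH.{u} where
  closed X :=
    { rightAdj := mapsFunctor X
      adj := Adjunction.mkOfHomEquiv
        { homEquiv := fun Z Y => curryEquiv X Y Z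
          homEquiv_naturality_left_symm := fun _ _ => rfl
          homEquiv_naturality_right := fun _ _ => rfl } }

open scoped MonoidalClosed

/-- The continuous map which is a given point of the internal hom. -/
def toMap {X Y : CGWH.{u}} (f : (ihom X).obj Y) : X ⟶ Y := (show mapsObj X Y from f).val

@[simp]
theorem toMap_curry {X Y Z : CGWH.{u}} (f : X ⊗ Z ⟶ Y) (x : X) (z : Z) :
  toMap (MonoidalClosed.curry f z) x = f (pair x z) := rfl
@[simp]
theorem uncurry_apply {X Y Z : CGWH.{u}} (f : Z ⟶ (ihom X).obj Y) (x : X) (z : Z) :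
  MonoidalClosed.uncurry f (pair x z) = toMap (f z) x := rfl
@[simp]
theorem ihom_map {X Y Z : CGWH.{u}} (f : Y ⟶ Z) (x : X) (z : (ihom X).obj Y) :
  toMap ((ihom X).map f z) x = f (toMap z x) := rfl
@[simp]
theorem eComp_pair {X Y Z : CGWH.{u}} (f : (ihom X).obj Y) (g : (ihom Y).obj Z) (x : X) :
  toMap (eComp CGWH X Y Z (pair f g)) x = toMap g (toMap f x) := rfl

instance : HasPullbacks CGWH.{u} := by
  refine @hasPullbacks_of_hasLimit_cospan _ _ fun {X Y Z} f g => ?_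
  have hc : ∀ x y : {p : X × Y // f p.1 = g p.2}, (∀ (Z : Type u) [TopologicalSpace Z]
      [WeaklyHausdorffSpace Z] (q : C({p : X × Y // f p.1 = g p.2}, Z)), q x = q y) → x = y :=
    fun _ _ h => Subtype.ext (Prod.ext
      (h X ⟨_, continuous_fst.comp continuous_subtype_val⟩)
      (h Y ⟨_, continuous_snd.comp continuous_subtype_val⟩))
  let P : CGWH.{u} :=
    { carrier := KSpace {p : X × Y // f p.1 = g p.2}
      weaklyHausdorff := KSpace.weaklyHausdorffSpace hc }
  let p₁ : P ⟶ X := ofHom ⟨fun p => p.val.1.1,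
    continuous_fst.comp (continuous_subtype_val.comp KSpace.continuous_val)⟩
  let p₂ : P ⟶ Y := ofHom ⟨fun p => p.val.1.2,
    continuous_snd.comp (continuous_subtype_val.comp KSpace.continuous_val)⟩
  have w : p₁ ≫ f = p₂ ≫ g := hom_ext fun p => p.val.2
  exact HasLimit.mk ⟨PullbackCone.mk p₁ p₂ w, PullbackCone.IsLimit.mk w
    (fun s => ofHom ⟨fun t => KSpace.mk ⟨(s.fst t, s.snd t), ConcreteCategory.congr_hom s.condition t⟩,
      KSpace.continuous_mk_comp (((continuous_hom s.fst).prodMk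
        (continuous_hom s.snd)).subtype_mk _)⟩)
    (fun _ => rfl) (fun _ => rfl)
    (fun s m h₁ h₂ => hom_ext fun t => KSpace.ext (Subtype.ext (Prod.ext
      (ConcreteCategory.congr_hom h₁ t) (ConcreteCategory.congr_hom h₂ t))))⟩

end CGWH

/-! ### Weak homotopy equivalences and Serre fibrations -/

/-- The map on path components induced by a continuous map. -/
def zerothHomotopyMap {X Y : Type*} [TopologicalSpace X] [TopologicalSpace Y] (f : C(X, Y)) :
    ZerothHomotopy X → ZerothHomotopy Y :=
  ZerothHomotopy.lift (fun x => ZerothHomotopy.mk (f x))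
    fun _ _ p => ZerothHomotopy.sound (p.map f.continuous)

/-- The map `π_n(X, x) → π_n(Y, f x)` induced by a continuous map. -/
def homotopyGroupMap {X Y : Type*} [TopologicalSpace X] [TopologicalSpace Y] (f : C(X, Y))
    (n : ℕ) (x : X) : HomotopyGroup.Pi n X x → HomotopyGroup.Pi n Y (f x) :=
  Quotient.map (sa := GenLoop.Homotopic.setoid (Fin n) x)
    (sb := GenLoop.Homotopic.setoid (Fin n) (f x))
    (fun γ => ⟨f.comp γ.1, fun y hy => congrArg f (γ.2 y hy)⟩)
    fun _ _ h => ContinuousMap.HomotopicRel.comp_continuousMap h f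

namespace CGWH

/-- A weak homotopy equivalence induces bijections on path components and on all homotopy groups
at all base points. -/
def IsWeakEquivalence {X Y : CGWH.{u}} (f : X ⟶ Y) : Prop :=
  Function.Bijective (zerothHomotopyMap f.hom) ∧
    ∀ (n : ℕ) (x : X), Function.Bijective (homotopyGroupMap f.hom (n + 1) x)

/-- Serre fibrations: maps with the right lifting property with respect to the inclusions
`[0, 1]ⁿ × {0} → [0, 1]ⁿ × [0, 1]`. -/
def IsSerreFibration {X Y : CGWH.{u}} (f : X ⟶ Y) : Prop :=
  ∀ (n : ℕ) (h : C(Fin n → unitInterval, X)) (H : C((Fin n → unitInterval) × unitInterval, Y)),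
    (∀ s, f (h s) = H (s, 0)) →
      ∃ K : C((Fin n → unitInterval) × unitInterval, X),
        (∀ s, K (s, 0) = h s) ∧ ∀ p, f (K p) = H p

end CGWH

/-! ### Topologically enriched categories and functors -/

namespace TopEnriched

open Opposite MonoidalClosed

section functors

variable {C : Type*} [EnrichedCategory CGWH.{u} C]
  {D : Type*} [Category* D] [EnrichedOrdinaryCategory CGWH.{u} D]

/-- The point of the hom-space corresponding to a morphism. -/
def pt {X Y : D} (f : X ⟶ Y) : (X ⟶[CGWH.{u}] Y : CGWH.{u}) :=
  eHomEquiv CGWH.{u} f PUnit.unit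

/-- The morphism corresponding to a point of the hom-space. -/
def ofPt {X Y : D} (x : (X ⟶[CGWH.{u}] Y : CGWH.{u})) : X ⟶ Y :=
  (eHomEquiv CGWH.{u}).symm (CGWH.ofHom ⟨fun _ => x, continuous_const⟩)

@[simp]
theorem pt_ofPt {X Y : D} (x : (X ⟶[CGWH.{u}] Y : CGWH.{u})) : pt (ofPt x) = x := by
  simp only [pt, ofPt, Equiv.apply_symm_apply]
  rfl

@[simp]
theorem ofPt_pt {X Y : D} (f : X ⟶ Y) : ofPt (pt.{u} f) = f := by
  apply (eHomEquiv CGWH.{u}).injective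
  simp only [pt, ofPt, Equiv.apply_symm_apply]
  rfl

theorem eComp_pt {X Y Z : D} (f : X ⟶ Y) (g : Y ⟶ Z) :
    eComp CGWH.{u} X Y Z (CGWH.pair (pt f) (pt g)) = pt (f ≫ g) := by
  simp only [pt, eHomEquiv_comp]
  rfl

theorem eHomWhiskerRight_pt {X Y Z : D} (f : X ⟶ Y) (g : Y ⟶ Z) :
    eHomWhiskerRight CGWH.{u} f Z (pt g) = pt (f ≫ g) := eComp_pt f g

theorem ofPt_ihom {X Y : CGWH.{u}} (x : (ihom X).obj Y) :
    ofPt (D := CGWH.{u}) x = CGWH.toMap x := rfl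

/-- Evaluation of enriched functors and enriched natural transformations at an object. -/
def evaluation (c : C) : EnrichedFunctor CGWH.{u} C D ⥤ D where
  obj F := F.obj c
  map η := (ForgetEnrichment.equivFunctor CGWH.{u} D).map (η.out.app (ForgetEnrichment.of _ c))
  map_id _ := (ForgetEnrichment.equivFunctor CGWH.{u} D).map_id _
  map_comp _ _ := (ForgetEnrichment.equivFunctor CGWH.{u} D).map_comp _ _

/-- The component of an enriched natural transformation at an object. -/
abbrev app {F F' : EnrichedFunctor CGWH.{u} C D} (η : F ⟶ F') (c : C) : F.obj c ⟶ F'.obj c :=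
  (evaluation c).map η

theorem naturality {F F' : EnrichedFunctor CGWH.{u} C D} (η : F ⟶ F') {c c' : C}
    (f : (c ⟶[CGWH.{u}] c' : CGWH.{u})) :
    ofPt (F.map c c' f) ≫ app η c' = app η c ≫ ofPt (F'.map c c' f) := by
  have h := congrArg (ForgetEnrichment.equivFunctor CGWH.{u} D).map
    (η.out.naturality (X := ForgetEnrichment.of _ c) (Y := ForgetEnrichment.of _ c')
      (ForgetEnrichment.homOf CGWH.{u} (CGWH.ofHom ⟨fun _ => f, continuous_const⟩)))
  rw [Functor.map_comp, Functor.map_comp] at h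
  exact h

/-- Precomposition `α^* : Fun(D, E) ⥤ Fun(C, E)` with an enriched functor `α : C → D`. -/
def restriction {D' : Type*} [EnrichedCategory CGWH.{u} D'] (α : EnrichedFunctor CGWH.{u} C D')
    (E : Type*) [Category* E] [EnrichedOrdinaryCategory CGWH.{u} E] :
    EnrichedFunctor CGWH.{u} D' E ⥤ EnrichedFunctor CGWH.{u} C E where
  obj F := α.comp CGWH.{u} F
  map η := ⟨{ app := fun X => η.out.app (α.forget.obj X)
              naturality := fun X Y f => by
                have h := η.out.naturality (α.forget.map f)
                simp only [EnrichedFunctor.forget_obj, EnrichedFunctor.forget_map,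
                  ForgetEnrichment.homTo_homOf, EnrichedFunctor.comp_map, Category.assoc] at h ⊢
                exact h }⟩

theorem app_restriction_map {D' : Type*} [EnrichedCategory CGWH.{u} D']
    (α : EnrichedFunctor CGWH.{u} C D') {F F' : EnrichedFunctor CGWH.{u} D' D} (η : F ⟶ F')
    (c : C) : app ((restriction α D).map η) c = app η (α.obj c) := rfl

end functors

/-! ### Tensors, cotensors and topological model categories -/

section tensors

variable {N : Type v} [Category.{w} N] [EnrichedOrdinaryCategory CGWH.{u} N]

/-- The morphism `N(P, L) ⟶ Map(T, N(M, L))` determined by a morphism `T ⟶ N(M, P)`. By the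
enriched Yoneda lemma, every enriched natural transformation in `L` is of this form. -/
def toTensorHom {T : CGWH.{u}} {M P : N} (a : T ⟶ (M ⟶[CGWH.{u}] P)) (L : N) :
    (P ⟶[CGWH.{u}] L) ⟶ (ihom T).obj (M ⟶[CGWH.{u}] L) :=
  curry (a ▷ (P ⟶[CGWH.{u}] L) ≫ eComp CGWH.{u} M P L)

/-- The morphism `N(M, P) ⟶ Map(T, N(M, L))` determined by a morphism `T ⟶ N(P, L)`. -/
def toCotensorHom {T : CGWH.{u}} {P L : N} (b : T ⟶ (P ⟶[CGWH.{u}] L)) (M : N) :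
    (M ⟶[CGWH.{u}] P) ⟶ (ihom T).obj (M ⟶[CGWH.{u}] L) :=
  curry ((β_ T (M ⟶[CGWH.{u}] P)).hom ≫ (M ⟶[CGWH.{u}] P) ◁ b ≫ eComp CGWH.{u} M P L)

/-- A tensor `T ⊗ M` of `M` by `T`: an object with isomorphisms
`N(T ⊗ M, L) ≅ Map(T, N(M, L))` in `CGWH`, natural in `L` in the enriched sense. -/
structure Tensor (T : CGWH.{u}) (M : N) where
  obj : N
  unit : T ⟶ (M ⟶[CGWH.{u}] obj)
  isIso (L : N) : IsIso (toTensorHom unit L)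

/-- A cotensor of `L` by `T`: an object `P` with isomorphisms `N(M, P) ≅ Map(T, N(M, L))`
in `CGWH`, natural in `M` in the enriched sense. -/
structure Cotensor (T : CGWH.{u}) (L : N) where
  obj : N
  counit : T ⟶ (obj ⟶[CGWH.{u}] L)
  isIso (M : N) : IsIso (toCotensorHom counit M)

variable (N) in
/-- Enriched completeness and cocompleteness: existence of all tensors and cotensors and of all
small conical enriched limits and colimits. -/
class IsTopBicomplete : Prop where
  tensor (T : CGWH.{u}) (M : N) : Nonempty (Tensor T M)
  cotensor (T : CGWH.{u}) (L : N) : Nonempty (Cotensor T L)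
  conicalLimits : Enriched.HasConicalLimitsOfSize.{u, u} CGWH.{u} N
  conicalColimits : Enriched.HasConicalLimitsOfSize.{u, u} CGWH.{u} Nᵒᵖ

/-- The pullback-power map `N(M', L) ⟶ N(M', L') ×_{N(M, L')} N(M, L)`. -/
def pullbackPower {M M' L L' : N} (i : M ⟶ M') (p : L ⟶ L') :
    (M' ⟶[CGWH.{u}] L) ⟶
      pullback (eHomWhiskerRight CGWH.{u} i L') (eHomWhiskerLeft CGWH.{u} M p) :=
  pullback.lift (eHomWhiskerLeft CGWH.{u} M' p) (eHomWhiskerRight CGWH.{u} i L)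
    (eHom_whisker_exchange CGWH.{u} i p)

variable (N) in
/-- A topological model category. -/
class IsTopologicalModelCategory [ModelCategory N] : Prop extends IsTopBicomplete.{u} N where
  isSerreFibration {M M' L L' : N} (i : M ⟶ M') (p : L ⟶ L') [Cofibration i] [Fibration p] :
    CGWH.IsSerreFibration (pullbackPower.{u} i p)
  isWeakEquivalence {M M' L L' : N} (i : M ⟶ M') (p : L ⟶ L') [Cofibration i] [Fibration p] :
    WeakEquivalence i ∨ WeakEquivalence p → CGWH.IsWeakEquivalence (pullbackPower.{u} i p)

end tensors

/-! ### Projective model structures and goodness -/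

section good

variable {C : Type*} [EnrichedCategory CGWH.{u} C]
  {N : Type v} [Category.{w} N] [EnrichedOrdinaryCategory CGWH.{u} N] [ModelCategory N]

/-- A model structure on `Fun(C, N)` is the projective one if its fibrations and weak equivalences
are the pointwise ones. -/
structure IsProjective (m : ModelCategory (EnrichedFunctor CGWH.{u} C N)) : Prop where
  fibration_iff {F F' : EnrichedFunctor CGWH.{u} C N} (η : F ⟶ F') :
    Fibration η ↔ ∀ c, Fibration (app η c)
  weakEquivalence_iff {F F' : EnrichedFunctor CGWH.{u} C N} (η : F ⟶ F') :
    WeakEquivalence η ↔ ∀ c, WeakEquivalence (app η c)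

/-- An enriched functor is projectively cofibrant if it is cofibrant in the projective model
structure. -/
def IsProjectivelyCofibrant (F : EnrichedFunctor CGWH.{u} C N) : Prop :=
  ∃ m : ModelCategory (EnrichedFunctor CGWH.{u} C N), IsProjective m ∧ IsCofibrant F

/-- A functor `U` between model categories is a right Quillen equivalence if it preserves
fibrations and trivial fibrations and has a left adjoint `L` such that for `X` cofibrant and `Y`
fibrant, a morphism `L X ⟶ Y` is a weak equivalence if and only if its adjunct `X ⟶ U Y` is. -/
def IsRightQuillenEquivalence {A B : Type*} [Category* A] [Category* B] [ModelCategory A]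
    [ModelCategory B] (U : B ⥤ A) : Prop :=
  (∀ ⦃X Y : B⦄ (f : X ⟶ Y), Fibration f → Fibration (U.map f)) ∧
  (∀ ⦃X Y : B⦄ (f : X ⟶ Y), Fibration f → WeakEquivalence f →
    Fibration (U.map f) ∧ WeakEquivalence (U.map f)) ∧
  ∃ (L : A ⥤ B) (adj : L ⊣ U), ∀ (X : A) (Y : B) (f : L.obj X ⟶ Y),
    IsCofibrant X → IsFibrant Y → (WeakEquivalence f ↔ WeakEquivalence (adj.homEquiv X Y f))

variable (N) in
/-- A topological model category `N` is good if the projective model structure on `Fun(C, N)`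
exists for every small topological category `C`, and restriction along every weak equivalence of
small topological categories that is bijective on objects is a right Quillen equivalence. -/
structure IsGood : Prop where
  exists_isProjective (C : Type u) [EnrichedCategory CGWH.{u} C] :
    ∃ m : ModelCategory (EnrichedFunctor CGWH.{u} C N), IsProjective m
  isRightQuillenEquivalence {C D : Type u} [EnrichedCategory CGWH.{u} C]
    [EnrichedCategory CGWH.{u} D] (α : EnrichedFunctor CGWH.{u} C D)
    (hobj : Function.Bijective α.obj)
    (hmap : ∀ c c' : C, CGWH.IsWeakEquivalence (α.map c c'))
    (mC : ModelCategory (EnrichedFunctor CGWH.{u} C N))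
    (mD : ModelCategory (EnrichedFunctor CGWH.{u} D N)) :
    IsProjective mC → IsProjective mD → IsRightQuillenEquivalence (restriction α N)

end good

/-! ### Coends -/

section coend

variable {N : Type v} [Category.{w} N] [EnrichedOrdinaryCategory CGWH.{u} N]
  [IsTopBicomplete.{u} N]

instance : HasColimitsOfSize.{u, u} N :=
  have : Enriched.HasConicalLimitsOfSize.{u, u} CGWH.{u} Nᵒᵖ := IsTopBicomplete.conicalColimits
  hasColimits_of_hasLimits_op

/-- A choice of tensor. -/
def tensorData (T : CGWH.{u}) (M : N) : Tensor T M := (IsTopBicomplete.tensor T M).some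

/-- The tensor `T ⊗ M`. -/
def tensor (T : CGWH.{u}) (M : N) : N := (tensorData T M).obj

/-- The universal morphism `T ⟶ N(M, T ⊗ M)`. -/
def tensorUnit (T : CGWH.{u}) (M : N) : T ⟶ (M ⟶[CGWH.{u}] tensor T M) := (tensorData T M).unit

/-- The isomorphism `N(T ⊗ M, L) ≅ Map(T, N(M, L))`. -/
def tensorIso (T : CGWH.{u}) (M L : N) :
    (tensor T M ⟶[CGWH.{u}] L) ≅ (ihom T).obj (M ⟶[CGWH.{u}] L) :=
  have : IsIso (toTensorHom (tensorUnit T M) L) := (tensorData T M).isIso L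
  asIso (toTensorHom (tensorUnit T M) L)

/-- The morphism `T ⊗ M ⟶ L` corresponding to a morphism `T ⟶ N(M, L)`. -/
def tensorDesc {T : CGWH.{u}} {M L : N} (φ : T ⟶ (M ⟶[CGWH.{u}] L)) : tensor T M ⟶ L :=
  (eHomEquiv CGWH.{u}).symm (curry' φ ≫ (tensorIso T M L).inv)

/-- The morphism `M ⟶ T ⊗ M` given by a point of `T`. -/
def tensorInj {T : CGWH.{u}} (t : T) (M : N) : M ⟶ tensor T M := ofPt (tensorUnit T M t)

/-- The enriched functoriality `Map(T, T') ⟶ N(T ⊗ M, T' ⊗ M)` of the tensor. -/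
def tensorHomLeft (T T' : CGWH.{u}) (M : N) :
    (ihom T).obj T' ⟶ (tensor T M ⟶[CGWH.{u}] tensor T' M) :=
  (ihom T).map (tensorUnit T' M) ≫ (tensorIso T M (tensor T' M)).inv

/-- The enriched functoriality `N(M, M') ⟶ N(T ⊗ M, T ⊗ M')` of the tensor. -/
def tensorHomRight (T : CGWH.{u}) (M M' : N) :
    (M ⟶[CGWH.{u}] M') ⟶ (tensor T M ⟶[CGWH.{u}] tensor T M') :=
  toCotensorHom (tensorUnit T M') M ≫ (tensorIso T M (tensor T M')).inv

/-- The morphism `T ⊗ M ⟶ T' ⊗ M'` induced by `T ⟶ T'` and `M ⟶ M'`. -/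
def tensorMap {T T' : CGWH.{u}} {M M' : N} (f : T ⟶ T') (g : M ⟶ M') : tensor T M ⟶ tensor T' M' :=
  tensorDesc (f ≫ tensorUnit T' M' ≫ eHomWhiskerRight CGWH.{u} g (tensor T' M'))

theorem tensorIso_hom_pt {T : CGWH.{u}} {M L : N} (f : tensor T M ⟶ L) (t : T) :
    CGWH.toMap ((tensorIso T M L).hom (pt f)) t = pt (tensorInj t M ≫ f) := by
  rw [← eComp_pt, tensorInj, pt_ofPt]
  rfl

theorem tensor_hom_ext {T : CGWH.{u}} {M L : N} {f g : tensor T M ⟶ L}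
    (h : ∀ t, tensorInj t M ≫ f = tensorInj t M ≫ g) : f = g := by
  have h₁ : (tensorIso T M L).hom (pt f) = (tensorIso T M L).hom (pt g) :=
    KSpace.ext (CGWH.hom_ext fun t =>
      (tensorIso_hom_pt f t).trans ((congrArg pt (h t)).trans (tensorIso_hom_pt g t).symm))
  have h₂ := congrArg (tensorIso T M L).inv h₁
  simp only [Iso.hom_inv_id_apply] at h₂
  rw [← ofPt_pt.{u} f, h₂, ofPt_pt]

theorem tensorInj_ofPt_tensorIso_inv {T : CGWH.{u}} {M L : N}
    (x : (ihom T).obj (M ⟶[CGWH.{u}] L)) (t : T) :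
    tensorInj t M ≫ ofPt ((tensorIso T M L).inv x) = ofPt (CGWH.toMap x t) := by
  rw [← ofPt_pt.{u} (tensorInj t M ≫ _), ← tensorIso_hom_pt, pt_ofPt, Iso.inv_hom_id_apply]

theorem tensorInj_tensorDesc {T : CGWH.{u}} {M L : N} (φ : T ⟶ (M ⟶[CGWH.{u}] L)) (t : T) :
    tensorInj t M ≫ tensorDesc φ = ofPt (φ t) :=
  tensorInj_ofPt_tensorIso_inv (KSpace.mk φ) t

theorem tensorInj_tensorHomLeft {T T' : CGWH.{u}} {M : N} (x : (ihom T).obj T') (t : T) :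
    tensorInj t M ≫ ofPt (tensorHomLeft T T' M x) = tensorInj (CGWH.toMap x t) M :=
  tensorInj_ofPt_tensorIso_inv _ t

theorem tensorInj_tensorHomRight {T : CGWH.{u}} {M M' : N} (x : (M ⟶[CGWH.{u}] M' : CGWH.{u}))
    (t : T) : tensorInj t M ≫ ofPt (tensorHomRight T M M' x) = ofPt x ≫ tensorInj t M' := by
  refine (tensorInj_ofPt_tensorIso_inv _ t).trans ?_
  rw [← ofPt_pt.{u} (ofPt x ≫ _), ← eComp_pt, pt_ofPt, tensorInj, pt_ofPt]
  rfl

theorem tensorInj_tensorMap {T T' : CGWH.{u}} {M M' : N} (f : T ⟶ T') (g : M ⟶ M') (t : T) :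
    tensorInj t M ≫ tensorMap f g = g ≫ tensorInj (f t) M' := by
  refine (tensorInj_tensorDesc _ t).trans ?_
  rw [← ofPt_pt.{u} (g ≫ _), ← eHomWhiskerRight_pt, tensorInj, pt_ofPt]
  rfl

variable {C : Type u} [EnrichedCategory CGWH.{u} C]

/-- The morphism `C(c, c') ⊗ (G(c') ⊗ F(c)) ⟶ G(c) ⊗ F(c)` given by the action of `C` on `G`. -/
def coendLeft (G : EnrichedFunctor CGWH.{u} Cᵒᵖ CGWH.{u}) (F : EnrichedFunctor CGWH.{u} C N)
    (c c' : C) :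
    tensor (c ⟶[CGWH.{u}] c') (tensor (G.obj (op c')) (F.obj c)) ⟶
      tensor (G.obj (op c)) (F.obj c) :=
  tensorDesc (G.map (op c') (op c) ≫ tensorHomLeft (G.obj (op c')) (G.obj (op c)) (F.obj c))

/-- The morphism `C(c, c') ⊗ (G(c') ⊗ F(c)) ⟶ G(c') ⊗ F(c')` given by the action of `C` on
`F`. -/
def coendRight (G : EnrichedFunctor CGWH.{u} Cᵒᵖ CGWH.{u}) (F : EnrichedFunctor CGWH.{u} C N)
    (c c' : C) :
    tensor (c ⟶[CGWH.{u}] c') (tensor (G.obj (op c')) (F.obj c)) ⟶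
      tensor (G.obj (op c')) (F.obj c') :=
  tensorDesc (F.map c c' ≫ tensorHomRight (G.obj (op c')) (F.obj c) (F.obj c'))

/-- The morphism `∐_{c, c'} C(c, c') ⊗ (G(c') ⊗ F(c)) ⟶ ∐_c G(c) ⊗ F(c)` given by the action
of `C` on `G`. -/
def coendFst (G : EnrichedFunctor CGWH.{u} Cᵒᵖ CGWH.{u}) (F : EnrichedFunctor CGWH.{u} C N) :
    (∐ fun p : C × C => tensor (p.1 ⟶[CGWH.{u}] p.2) (tensor (G.obj (op p.2)) (F.obj p.1))) ⟶
      ∐ fun c : C => tensor (G.obj (op c)) (F.obj c) :=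
  Sigma.desc fun p => coendLeft G F p.1 p.2 ≫
    Sigma.ι (fun c : C => tensor (G.obj (op c)) (F.obj c)) p.1

/-- The morphism `∐_{c, c'} C(c, c') ⊗ (G(c') ⊗ F(c)) ⟶ ∐_c G(c) ⊗ F(c)` given by the action
of `C` on `F`. -/
def coendSnd (G : EnrichedFunctor CGWH.{u} Cᵒᵖ CGWH.{u}) (F : EnrichedFunctor CGWH.{u} C N) :
    (∐ fun p : C × C => tensor (p.1 ⟶[CGWH.{u}] p.2) (tensor (G.obj (op p.2)) (F.obj p.1))) ⟶
      ∐ fun c : C => tensor (G.obj (op c)) (F.obj c) :=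
  Sigma.desc fun p => coendRight G F p.1 p.2 ≫
    Sigma.ι (fun c : C => tensor (G.obj (op c)) (F.obj c)) p.2

/-- The coend `∫^C G ⊗ F`: the coequalizer of the two morphisms
`∐_{c, c'} C(c, c') ⊗ (G(c') ⊗ F(c)) ⇉ ∐_c G(c) ⊗ F(c)`. -/
def coend (G : EnrichedFunctor CGWH.{u} Cᵒᵖ CGWH.{u}) (F : EnrichedFunctor CGWH.{u} C N) : N :=
  coequalizer (coendFst G F) (coendSnd G F)

/-- The canonical morphism `G(c) ⊗ F(c) ⟶ ∫^C G ⊗ F`. -/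
def coendι (G : EnrichedFunctor CGWH.{u} Cᵒᵖ CGWH.{u}) (F : EnrichedFunctor CGWH.{u} C N) (c : C) :
    tensor (G.obj (op c)) (F.obj c) ⟶ coend G F :=
  Sigma.ι (fun c : C => tensor (G.obj (op c)) (F.obj c)) c ≫
    coequalizer.π (coendFst G F) (coendSnd G F)

theorem coend_condition (G : EnrichedFunctor CGWH.{u} Cᵒᵖ CGWH.{u})
    (F : EnrichedFunctor CGWH.{u} C N) (c c' : C) :
    coendLeft G F c c' ≫ coendι G F c = coendRight G F c c' ≫ coendι G F c' := by
  have h := congrArg (fun k => Sigma.ι (fun p : C × C => tensor (p.1 ⟶[CGWH.{u}] p.2)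
    (tensor (G.obj (op p.2)) (F.obj p.1))) (c, c') ≫ k)
    (coequalizer.condition (coendFst G F) (coendSnd G F))
  simp only [coendFst, coendSnd, Sigma.ι_desc_assoc, Category.assoc] at h
  exact h

theorem tensorInj_coendLeft (G : EnrichedFunctor CGWH.{u} Cᵒᵖ CGWH.{u})
    (F : EnrichedFunctor CGWH.{u} C N) {c c' : C} (f : (c ⟶[CGWH.{u}] c' : CGWH.{u}))
    (g : G.obj (op c')) :
    tensorInj g (F.obj c) ≫ tensorInj f _ ≫ coendLeft G F c c' =
      tensorInj (CGWH.toMap (G.map (op c') (op c) f) g) (F.obj c) := by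
  rw [coendLeft, tensorInj_tensorDesc]
  exact tensorInj_tensorHomLeft _ g

theorem tensorInj_coendRight (G : EnrichedFunctor CGWH.{u} Cᵒᵖ CGWH.{u})
    (F : EnrichedFunctor CGWH.{u} C N) {c c' : C} (f : (c ⟶[CGWH.{u}] c' : CGWH.{u}))
    (g : G.obj (op c')) :
    tensorInj g (F.obj c) ≫ tensorInj f _ ≫ coendRight G F c c' =
      ofPt (F.map c c' f) ≫ tensorInj g (F.obj c') := by
  rw [coendRight, tensorInj_tensorDesc]
  exact tensorInj_tensorHomRight _ g

theorem coend_condition_apply (G : EnrichedFunctor CGWH.{u} Cᵒᵖ CGWH.{u})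
    (F : EnrichedFunctor CGWH.{u} C N) {c c' : C} (f : (c ⟶[CGWH.{u}] c' : CGWH.{u}))
    (g : G.obj (op c')) :
    tensorInj (CGWH.toMap (G.map (op c') (op c) f) g) (F.obj c) ≫ coendι G F c =
      ofPt (F.map c c' f) ≫ tensorInj g (F.obj c') ≫ coendι G F c' := by
  rw [← tensorInj_coendLeft, Category.assoc, Category.assoc, coend_condition,
    ← Category.assoc, ← Category.assoc, Category.assoc (tensorInj g (F.obj c)),
    tensorInj_coendRight, Category.assoc]

theorem coendMap_aux {G G' : EnrichedFunctor CGWH.{u} Cᵒᵖ CGWH.{u}}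
    {F F' : EnrichedFunctor CGWH.{u} C N} (η : G ⟶ G') (θ : F ⟶ F') (c c' : C) :
    coendLeft G F c c' ≫ tensorMap (app η (op c)) (app θ c) ≫ coendι G' F' c =
      coendRight G F c c' ≫ tensorMap (app η (op c')) (app θ c') ≫ coendι G' F' c' := by
  refine tensor_hom_ext fun f => tensor_hom_ext fun g => ?_
  have h₁ : app η (op c) (CGWH.toMap (G.map (op c') (op c) f) g) =
      CGWH.toMap (G'.map (op c') (op c) f) (app η (op c') g) :=
    ConcreteCategory.congr_hom (naturality η (c := op c') (c' := op c) f) g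
  have hl := tensorInj_coendLeft G F f g
  have hr := tensorInj_coendRight G F f g
  calc tensorInj g _ ≫ tensorInj f _ ≫ coendLeft G F c c' ≫
        tensorMap (app η (op c)) (app θ c) ≫ coendι G' F' c
      = (tensorInj g _ ≫ tensorInj f _ ≫ coendLeft G F c c') ≫
        tensorMap (app η (op c)) (app θ c) ≫ coendι G' F' c := by simp only [Category.assoc]
    _ = (app θ c ≫ ofPt (F'.map c c' f)) ≫
        tensorInj (app η (op c') g) _ ≫ coendι G' F' c' := by
      rw [hl, ← Category.assoc, tensorInj_tensorMap, h₁, Category.assoc, coend_condition_apply,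
        Category.assoc]
    _ = (tensorInj g _ ≫ tensorInj f _ ≫ coendRight G F c c') ≫
        tensorMap (app η (op c')) (app θ c') ≫ coendι G' F' c' := by
      rw [hr, ← naturality, Category.assoc, Category.assoc, ← Category.assoc (tensorInj g _),
        tensorInj_tensorMap, Category.assoc]
    _ = _ := by simp only [Category.assoc]

/-- The morphism of coends induced by enriched natural transformations. -/
def coendMap {G G' : EnrichedFunctor CGWH.{u} Cᵒᵖ CGWH.{u}} {F F' : EnrichedFunctor CGWH.{u} C N}
    (η : G ⟶ G') (θ : F ⟶ F') : coend G F ⟶ coend G' F' :=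
  coequalizer.desc
    (Sigma.desc fun c => tensorMap (app η (op c)) (app θ c) ≫ coendι G' F' c)
    (Sigma.hom_ext _ _ fun p => by
      simpa [coendFst, coendSnd] using coendMap_aux η θ p.1 p.2)

theorem coendι_coendMap {G G' : EnrichedFunctor CGWH.{u} Cᵒᵖ CGWH.{u}}
    {F F' : EnrichedFunctor CGWH.{u} C N} (η : G ⟶ G') (θ : F ⟶ F') (c : C) :
    coendι G F c ≫ coendMap η θ = tensorMap (app η (op c)) (app θ c) ≫ coendι G' F' c := by
  exact (Category.assoc _ _ _).trans ((congrArg _ (coequalizer.π_desc _ _)).trans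
    (Sigma.ι_desc _ _))

end coend

end TopEnriched

end

open MonoidalClosed TopEnriched

/-! The proof realizes a coend as one value of a left Kan extension. The collage of `G` adjoins to
`C` one object, the apex, with hom-space `G(c)` from `c` to the apex, no morphisms back, and only
the identity on the apex. A functor from the collage to `N` is a functor `H` on `C`, an object `Z`
and a compatible family `G(c) ⟶ N(H(c), Z)`; the family amounts to a morphism `∫^C G ⊗ H ⟶ Z`. Hence
restriction along the inclusion of `C` has a left adjoint (`extendAdjunction`), which keeps `F` on
`C` and takes the value `∫^C G ⊗ F` at the apex. Restriction preserves pointwise fibrations and weak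
equivalences, so this left adjoint is left Quillen for the projective structures.

Invariance in `F` is then Ken Brown's lemma (`weakEquivalence_map_of_isCofibrant`), read at the
apex.

For invariance in `G`, a pointwise weak equivalence `η : G ⟶ G'` induces a functor `α` of collages
that is bijective on objects and a weak equivalence on hom-spaces, so goodness makes `α^*` a right
Quillen equivalence. Since `α` commutes with the inclusions of `C`, the extension of `F` over the
collage of `G'` is the left Kan extension along `α` of the one over the collage of `G`
(`extendComparison_universal`). The latter is cofibrant and `α^*` preserves all weak equivalences,
so the universal arrow is a weak equivalence (`weakEquivalence_of_universal`); at the apex it is the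
map of coends. -/

/-! ### Quillen adjunctions -/

namespace HomotopicalAlgebra

variable {A B : Type*} [Category* A] [Category* B] [ModelCategory A] [ModelCategory B]
  {L : A ⥤ B} {U : B ⥤ A}

/-- Cofibrations are the maps with the left lifting property against trivial fibrations, and lifting
problems transpose across the adjunction. -/
theorem cofibration_map_of_adjunction (adj : L ⊣ U)
    (hU : ∀ ⦃X Y : B⦄ (f : X ⟶ Y), Fibration f → WeakEquivalence f →
      Fibration (U.map f) ∧ WeakEquivalence (U.map f))
    {X Y : A} (i : X ⟶ Y) [Cofibration i] : Cofibration (L.map i) := by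
  rw [cofibration_iff, ← trivialFibrations_llp]
  intro P Q p hp
  obtain ⟨h₁, h₂⟩ := (mem_trivialFibrations_iff p).1 hp
  obtain ⟨_, _⟩ := hU p h₁ h₂
  rw [adj.hasLiftingProperty_iff]
  infer_instance

/-- The same transposition, now against all fibrations, which detect trivial cofibrations. -/
theorem weakEquivalence_map_of_adjunction (adj : L ⊣ U)
    (hU : ∀ ⦃X Y : B⦄ (f : X ⟶ Y), Fibration f → Fibration (U.map f))
    {X Y : A} (i : X ⟶ Y) [Cofibration i] [WeakEquivalence i] : WeakEquivalence (L.map i) := by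
  have h : trivialCofibrations B (L.map i) := by
    rw [← fibrations_llp]
    intro P Q p hp
    have := hU p ((fibration_iff p).2 hp)
    rw [adj.hasLiftingProperty_iff]
    infer_instance
  exact ((mem_trivialCofibrations_iff _).1 h).2

theorem isCofibrant_obj_of_adjunction (adj : L ⊣ U)
    (hU : ∀ ⦃X Y : B⦄ (f : X ⟶ Y), Fibration f → WeakEquivalence f →
      Fibration (U.map f) ∧ WeakEquivalence (U.map f))
    (X : A) [IsCofibrant X] : IsCofibrant (L.obj X) := by
  have hi : Cofibration (L.map (initial.to X)) := cofibration_map_of_adjunction adj hU _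
  -- A left adjoint preserves the initial object, so the cofibration `hi` starts at an initial
  -- object.
  have : L.IsLeftAdjoint := ⟨_, ⟨adj⟩⟩
  exact (isCofibrant_iff_of_isInitial (L.map (initial.to X))
    (IsInitial.isInitialObj L _ initialIsInitial)).2 hi

/-- A left Quillen functor preserves weak equivalences between cofibrant objects. -/
theorem weakEquivalence_map_of_isCofibrant (adj : L ⊣ U)
    (hU : ∀ ⦃X Y : B⦄ (f : X ⟶ Y), Fibration f → Fibration (U.map f))
    {X Y : A} [IsCofibrant X] [IsCofibrant Y] (f : X ⟶ Y) [WeakEquivalence f] :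
    WeakEquivalence (L.map f) := by
  -- Ken Brown's factorization `f = i ≫ p`: `i` is a trivial cofibration, and `p` has a section `s`
  -- that is one too. Since `L` sends `s` to a weak equivalence, two-out-of-three handles `p`.
  let h : CofibrantBrownFactorization f := Classical.arbitrary _
  have : WeakEquivalence (L.map h.i) := weakEquivalence_map_of_adjunction adj hU _
  have : WeakEquivalence (L.map h.s) := weakEquivalence_map_of_adjunction adj hU _
  have : WeakEquivalence (L.map h.s ≫ L.map h.p) := by
    rw [← L.map_comp, h.s_p, L.map_id]
    infer_instance
  have : WeakEquivalence (L.map h.p) := weakEquivalence_of_precomp (L.map h.s) _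
  rw [← h.fac, L.map_comp]
  infer_instance

/-- Let `U` be a right Quillen equivalence which preserves weak equivalences. Then a universal
arrow from a cofibrant object to `U` is a weak equivalence. -/
theorem weakEquivalence_of_universal (hU : IsRightQuillenEquivalence U)
    (hw : ∀ ⦃X Y : B⦄ (f : X ⟶ Y), WeakEquivalence f → WeakEquivalence (U.map f))
    {X : A} [IsCofibrant X] {Y : B} (a : X ⟶ U.obj Y)
    (ha : ∀ (Z : B) (g : X ⟶ U.obj Z), ∃! h : Y ⟶ Z, a ≫ U.map h = g) : WeakEquivalence a := by
  obtain ⟨-, -, L, adj, hL⟩ := hU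
  -- Both `a` and the unit at `X` are universal arrows from `X` to `U`, so `φ` is invertible; its
  -- inverse `ψ` is the factorization of the unit through `a`.
  let φ : L.obj X ⟶ Y := (adj.homEquiv _ _).symm a
  obtain ⟨ψ, hψ, -⟩ := ha _ (adj.unit.app X)
  have hφ : adj.unit.app X ≫ U.map φ = a :=
    (adj.homEquiv_unit ..).symm.trans (Equiv.apply_symm_apply _ _)
  have h₁ : φ ≫ ψ = 𝟙 _ := by
    apply (adj.homEquiv _ _).injective
    simp [adj.homEquiv_unit, reassoc_of% hφ, hψ]
  have h₂ : ψ ≫ φ = 𝟙 _ :=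
    (ha _ a).unique (by rw [U.map_comp, reassoc_of% hψ, hφ]) (by simp)
  have : IsIso φ := ⟨ψ, h₁, h₂⟩
  -- The Quillen equivalence criterion needs a fibrant target, so `Y` is replaced by `d.Z` along the
  -- trivial cofibration `d.i`. The adjunct of `φ ≫ d.i` is `a ≫ U.map d.i`, and `hw` then allows
  -- `U.map d.i` to be cancelled.
  let d := MorphismProperty.factorizationData (trivialCofibrations B) (fibrations B)
    (terminal.from Y)
  have : IsFibrant d.Z := by
    rw [isFibrant_iff, Subsingleton.elim (terminal.from d.Z) d.p]
    infer_instance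
  have h₃ : WeakEquivalence (a ≫ U.map d.i) := by
    have h := (hL X d.Z (φ ≫ d.i) inferInstance inferInstance).1 inferInstance
    rwa [adj.homEquiv_naturality_right, Equiv.apply_symm_apply] at h
  have := hw d.i inferInstance
  exact weakEquivalence_of_postcomp a (U.map d.i)

end HomotopicalAlgebra

/-! ### Weak homotopy equivalences -/

theorem CGWH.isWeakEquivalence_id (X : CGWH.{u}) : CGWH.IsWeakEquivalence (𝟙 X) := by
  refine ⟨?_, fun n x => ?_⟩
  · have h : zerothHomotopyMap (CGWH.Hom.hom (𝟙 X)) = id := by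
      funext a
      induction a using Quotient.inductionOn
      rfl
    rw [h]
    exact Function.bijective_id
  · have h : homotopyGroupMap (CGWH.Hom.hom (𝟙 X)) (n + 1) x = id := by
      funext a
      induction a using Quotient.inductionOn
      rfl
    rw [h]
    exact Function.bijective_id

namespace TopEnriched

open Opposite

/-! ### Enriched functors and natural transformations in terms of points -/

section points

variable {C : Type*} [EnrichedCategory CGWH.{u} C]
  {D : Type*} [Category* D] [EnrichedOrdinaryCategory CGWH.{u} D]

/-- With `ofPt_injective`, points of a hom-space and morphisms become interchangeable: enriched
identities can be verified on points, in the underlying category. -/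
theorem pt_injective {X Y : D} : Function.Injective (pt.{u} : (X ⟶ Y) → _) :=
  Function.LeftInverse.injective ofPt_pt

theorem ofPt_injective {X Y : D} :
    Function.Injective (ofPt : (X ⟶[CGWH.{u}] Y : CGWH.{u}) → (X ⟶ Y)) :=
  Function.LeftInverse.injective pt_ofPt

theorem ofPt_eComp {X Y Z : D} (x : (X ⟶[CGWH.{u}] Y : CGWH.{u}))
    (y : (Y ⟶[CGWH.{u}] Z : CGWH.{u})) :
    ofPt (eComp CGWH.{u} X Y Z (CGWH.pair x y)) = ofPt x ≫ ofPt y := by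
  apply pt_injective.{u}
  rw [← eComp_pt, pt_ofPt, pt_ofPt, pt_ofPt]

theorem ofPt_eId (X : D) : ofPt (eId CGWH.{u} X PUnit.unit) = 𝟙 X := by
  apply pt_injective.{u}
  rw [pt_ofPt, pt, eHomEquiv_id]

theorem ofPt_eHomWhiskerLeft (X : D) {Y Z : D} (g : Y ⟶ Z)
    (x : (X ⟶[CGWH.{u}] Y : CGWH.{u})) :
    ofPt (eHomWhiskerLeft CGWH.{u} X g x) = ofPt x ≫ g := by
  rw [← ofPt_pt.{u} g, ← ofPt_eComp, ofPt_pt]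
  rfl

theorem ofPt_eHomWhiskerRight {X Y : D} (f : X ⟶ Y) (Z : D)
    (x : (Y ⟶[CGWH.{u}] Z : CGWH.{u})) :
    ofPt (eHomWhiskerRight CGWH.{u} f Z x) = f ≫ ofPt x := by
  rw [← ofPt_pt.{u} f, ← ofPt_eComp, ofPt_pt]
  rfl

/-- This and the next lemmas evaluate the enriched axioms at points, the form in which the collage
is handled. -/
theorem map_eComp {D' : Type*} [EnrichedCategory CGWH.{u} D'] (F : EnrichedFunctor CGWH.{u} C D')
    {c c' c'' : C} (f : (c ⟶[CGWH.{u}] c' : CGWH.{u})) (g : (c' ⟶[CGWH.{u}] c'' : CGWH.{u})) :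
    F.map c c'' (eComp CGWH.{u} c c' c'' (CGWH.pair f g)) =
      eComp CGWH.{u} _ _ _ (CGWH.pair (F.map c c' f) (F.map c' c'' g)) :=
  ConcreteCategory.congr_hom (F.map_comp c c' c'') (CGWH.pair f g)

theorem map_eId {D' : Type*} [EnrichedCategory CGWH.{u} D'] (F : EnrichedFunctor CGWH.{u} C D')
    (c : C) : F.map c c (eId CGWH.{u} c PUnit.unit) = eId CGWH.{u} (F.obj c) PUnit.unit :=
  ConcreteCategory.congr_hom (F.map_id c) PUnit.unit

theorem eComp_eId_left {c c' : C} (f : (c ⟶[CGWH.{u}] c' : CGWH.{u})) :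
    eComp CGWH.{u} c c c' (CGWH.pair (eId CGWH.{u} c PUnit.unit) f) = f :=
  ConcreteCategory.congr_hom (e_id_comp CGWH.{u} c c') f

theorem eComp_eId_right {c c' : C} (f : (c ⟶[CGWH.{u}] c' : CGWH.{u})) :
    eComp CGWH.{u} c c' c' (CGWH.pair f (eId CGWH.{u} c' PUnit.unit)) = f :=
  ConcreteCategory.congr_hom (e_comp_id CGWH.{u} c c') f

theorem eComp_assoc {b c d e : C} (f : (b ⟶[CGWH.{u}] c : CGWH.{u}))
    (g : (c ⟶[CGWH.{u}] d : CGWH.{u})) (h : (d ⟶[CGWH.{u}] e : CGWH.{u})) :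
    eComp CGWH.{u} b d e (CGWH.pair (eComp CGWH.{u} b c d (CGWH.pair f g)) h) =
      eComp CGWH.{u} b c e (CGWH.pair f (eComp CGWH.{u} c d e (CGWH.pair g h))) :=
  ConcreteCategory.congr_hom (e_assoc CGWH.{u} b c d e) (CGWH.pair f (CGWH.pair g h))

theorem natTrans_ext {F F' : EnrichedFunctor CGWH.{u} C D} {η η' : F ⟶ F'}
    (h : ∀ c, app η c = app η' c) : η = η' :=
  EnrichedFunctor.hom_ext fun c => (eHomEquiv CGWH.{u}).symm.injective (h c)

/-- The enriched natural transformation with given components. -/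
def natTransMk {F F' : EnrichedFunctor CGWH.{u} C D} (a : ∀ c, F.obj c ⟶ F'.obj c)
    (ha : ∀ (c c' : C) (f : (c ⟶[CGWH.{u}] c' : CGWH.{u})),
      ofPt (F.map c c' f) ≫ a c' = a c ≫ ofPt (F'.map c c' f)) : F ⟶ F' :=
  ⟨{ app := fun c => ForgetEnrichment.homOf CGWH.{u} (X := F.obj c) (Y := F'.obj c) (eHomEquiv CGWH.{u} (a c))
     naturality := fun c c' f => by
      -- Naturality is required only for morphisms `𝟙_ ⟶ C(c, c')`, that is, for points of the
      -- hom-space, so `ha` suffices once both sides are carried to `D`.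
      apply (ForgetEnrichment.equiv CGWH.{u} (D := D)).functor.map_injective
      have h := ha c c' (ForgetEnrichment.homTo CGWH.{u} f PUnit.unit)
      have key : ∀ G : EnrichedFunctor CGWH.{u} C D,
          (ForgetEnrichment.equivFunctor CGWH.{u} D).map (G.forget.map f) =
            ofPt (G.map c c' (ForgetEnrichment.homTo CGWH.{u} f PUnit.unit)) := fun _ => rfl
      have key' : ∀ d, (ForgetEnrichment.equivFunctor CGWH.{u} D).map
          (ForgetEnrichment.homOf CGWH.{u} (eHomEquiv CGWH.{u} (a d))) = a d :=
        fun d => Equiv.symm_apply_apply _ _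
      refine (Functor.map_comp (ForgetEnrichment.equivFunctor CGWH.{u} D) _ _).trans
        (Eq.trans ?_ (Functor.map_comp (ForgetEnrichment.equivFunctor CGWH.{u} D) _ _).symm)
      rw [key, key]
      erw [key', key']
      exact h }⟩

@[simp]
theorem app_natTransMk {F F' : EnrichedFunctor CGWH.{u} C D} (a : ∀ c, F.obj c ⟶ F'.obj c)
    (ha : ∀ (c c' : C) (f : (c ⟶[CGWH.{u}] c' : CGWH.{u})),
      ofPt (F.map c c' f) ≫ a c' = a c ≫ ofPt (F'.map c c' f)) (c : C) :
    app (natTransMk a ha) c = a c :=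
  Equiv.symm_apply_apply _ _

theorem app_comp {F F' F'' : EnrichedFunctor CGWH.{u} C D} (η : F ⟶ F') (θ : F' ⟶ F'') (c : C) :
    app (η ≫ θ) c = app η c ≫ app θ c := (evaluation c).map_comp η θ

theorem app_id (F : EnrichedFunctor CGWH.{u} C D) (c : C) : app (𝟙 F) c = 𝟙 (F.obj c) :=
  (evaluation c).map_id F

end points

end TopEnriched

namespace TopEnriched

open Opposite

/-! ### The collage of a presheaf -/

instance : WeaklyHausdorffSpace PEmpty.{u + 1} := ⟨fun _ _ _ _ _ => (Set.toFinite _).isClosed⟩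

/-- The empty space. -/
abbrev emptySpace : CGWH.{u} := ⟨PEmpty⟩

/-- The morphism from a space without points. -/
def fromEmpty {X : CGWH.{u}} (h : X → PEmpty.{u + 1}) (Y : CGWH.{u}) : X ⟶ Y :=
  CGWH.ofHom ⟨fun x => (h x).elim, continuous_iff_continuousAt.2 fun x => (h x).elim⟩

section collage

variable {C : Type u} [EnrichedCategory CGWH.{u} C]

/-- The objects of the collage of a presheaf `G` on `C`: those of `C` and one additional object. -/
inductive Collage (G : EnrichedFunctor CGWH.{u} Cᵒᵖ CGWH.{u}) : Type u
  | of (c : C) : Collage G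
  | apex : Collage G

/-- The action of `C` on a presheaf. -/
def presheafAct (G : EnrichedFunctor CGWH.{u} Cᵒᵖ CGWH.{u}) {c c' : C}
    (f : (c ⟶[CGWH.{u}] c' : CGWH.{u})) (g : G.obj (op c')) : G.obj (op c) :=
  CGWH.toMap (G.map (op c') (op c) f) g

theorem presheafAct_eId (G : EnrichedFunctor CGWH.{u} Cᵒᵖ CGWH.{u}) {c : C} (g : G.obj (op c)) :
    presheafAct G (eId CGWH.{u} c PUnit.unit) g = g :=
  congrArg (fun x => CGWH.toMap x g) (map_eId G (op c))

theorem presheafAct_eComp (G : EnrichedFunctor CGWH.{u} Cᵒᵖ CGWH.{u}) {c c' c'' : C}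
    (f : (c ⟶[CGWH.{u}] c' : CGWH.{u})) (f' : (c' ⟶[CGWH.{u}] c'' : CGWH.{u}))
    (g : G.obj (op c'')) :
    presheafAct G (eComp CGWH.{u} c c' c'' (CGWH.pair f f')) g =
      presheafAct G f (presheafAct G f' g) :=
  congrArg (fun x => CGWH.toMap x g) (map_eComp G (c := op c'') (c' := op c') (c'' := op c) f' f)

theorem app_presheafAct {G G' : EnrichedFunctor CGWH.{u} Cᵒᵖ CGWH.{u}} (η : G ⟶ G') {c c' : C}
    (f : (c ⟶[CGWH.{u}] c' : CGWH.{u})) (g : G.obj (op c')) :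
    app η (op c) (presheafAct G f g) = presheafAct G' f (app η (op c') g) :=
  ConcreteCategory.congr_hom (naturality η (c := op c') (c' := op c) f) g

namespace Collage

variable (G : EnrichedFunctor CGWH.{u} Cᵒᵖ CGWH.{u})

/-- The hom-spaces of the collage. -/
def homSpace : Collage G → Collage G → CGWH.{u}
  | of c, of c' => c ⟶[CGWH.{u}] c'
  | of c, apex => G.obj (op c)
  | apex, of _ => emptySpace
  | apex, apex => 𝟙_ CGWH.{u}

/-- The identities of the collage. -/
def idPt : ∀ X : Collage G, 𝟙_ CGWH.{u} ⟶ homSpace G X X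
  | of c => eId CGWH.{u} c
  | apex => 𝟙 _

/-- The composition of the collage. -/
def compPt : ∀ X Y Z : Collage G, homSpace G X Y ⊗ homSpace G Y Z ⟶ homSpace G X Z
  | of c, of c', of c'' => eComp CGWH.{u} c c' c''
  -- The action of `C` on `G`. The braiding is needed because `uncurry` takes the point of `G(c')`
  -- before the morphism acting on it.
  | of c, of c', apex => (β_ _ _).hom ≫ MonoidalClosed.uncurry (G.map (op c') (op c))
  | of c, apex, apex => (ρ_ (G.obj (op c))).hom
  | _, apex, of _ => fromEmpty (fun p => (KSpace.val p).2) _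
  | apex, of _, _ => fromEmpty (fun p => (KSpace.val p).1) _
  | apex, apex, apex => (ρ_ (𝟙_ CGWH.{u})).hom

/-- The axioms with all objects in `C` are those of `C`. When only the last object is the apex, they
say that `C` acts on `G` unitally and associatively. The remaining cases involve an empty hom-space
or hold by definition. -/
instance : EnrichedCategory CGWH.{u} (Collage G) where
  Hom := homSpace G
  id := idPt G
  comp := compPt G
  id_comp X Y := by
    refine CGWH.hom_ext fun f => ?_
    rcases X with c | _ <;> rcases Y with c' | _
    · exact eComp_eId_left (C := C) f
    · exact presheafAct_eId G f
    · exact PEmpty.elim f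
    · rfl
  comp_id X Y := by
    refine CGWH.hom_ext fun f => ?_
    rcases X with c | _ <;> rcases Y with c' | _
    · exact eComp_eId_right (C := C) f
    · rfl
    · exact PEmpty.elim f
    · rfl
  assoc W X Y Z := by
    refine CGWH.hom_ext fun p => ?_
    obtain ⟨f, q, rfl⟩ := CGWH.pair_surjective p
    obtain ⟨g, h, rfl⟩ := CGWH.pair_surjective q
    rcases W with b | _ <;> rcases X with c | _ <;> rcases Y with d | _ <;> rcases Z with e | _ <;>
      try first
      | exact PEmpty.elim f
      | exact PEmpty.elim g
      | exact PEmpty.elim h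
      | rfl
    · exact eComp_assoc (C := C) f g h
    · exact presheafAct_eComp G f g h

/-- The inclusion of `C` into the collage. -/
def incl : EnrichedFunctor CGWH.{u} C (Collage G) where
  obj := of
  map c c' := 𝟙 (c ⟶[CGWH.{u}] c')
  map_id _ := rfl
  map_comp _ _ _ := rfl

variable {G} {G' : EnrichedFunctor CGWH.{u} Cᵒᵖ CGWH.{u}} (η : G ⟶ G')

/-- The functoriality of the collage on objects. -/
def mapObj : Collage G → Collage G'
  | of c => of c
  | apex => apex

variable (G G') in
theorem mapObj_bijective : Function.Bijective (mapObj : Collage G → Collage G') :=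
  Function.bijective_iff_has_inverse.2 ⟨mapObj, by rintro (_ | _) <;> rfl, by rintro (_ | _) <;> rfl⟩

/-- The functoriality of the collage on hom-spaces. -/
def mapHom : ∀ X Y : Collage G, homSpace G X Y ⟶ homSpace G' (mapObj X) (mapObj Y)
  | of c, of c' => 𝟙 (c ⟶[CGWH.{u}] c')
  | of c, apex => app η (op c)
  | apex, of _ => 𝟙 emptySpace
  | apex, apex => 𝟙 (𝟙_ CGWH.{u})

/-- The functoriality of the collage. -/
def map : EnrichedFunctor CGWH.{u} (Collage G) (Collage G') where
  obj := mapObj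
  map := mapHom η
  map_id X := by rcases X with _ | _ <;> rfl
  map_comp X Y Z := by
    refine CGWH.hom_ext fun p => ?_
    obtain ⟨f, g, rfl⟩ := CGWH.pair_surjective p
    -- The only case with content is `c`, `d`, apex, where functoriality is the naturality of `η`.
    rcases X with c | _ <;> rcases Y with d | _ <;> rcases Z with e | _ <;>
      first
      | exact PEmpty.elim f
      | exact PEmpty.elim g
      | rfl
      | exact app_presheafAct η f g

/-- Only the hom-spaces from `C` to the apex change, and there the map is a component of `η`. -/
theorem isWeakEquivalence_map (hη : ∀ c, CGWH.IsWeakEquivalence (app η c)) :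
    ∀ X Y : Collage G, CGWH.IsWeakEquivalence ((map η).map X Y)
  | of _, of _ => CGWH.isWeakEquivalence_id _
  | of c, apex => hη (op c)
  | apex, of _ => CGWH.isWeakEquivalence_id _
  | apex, apex => CGWH.isWeakEquivalence_id _

end Collage

end collage

end TopEnriched

namespace TopEnriched

open Opposite

/-! ### Extension to the collage -/

noncomputable section

section extension

variable {N : Type v} [Category.{w} N] [EnrichedOrdinaryCategory CGWH.{u} N]
  [IsTopBicomplete.{u} N] {C : Type u} [EnrichedCategory CGWH.{u} C]

/-- The coend is a quotient of a coproduct of tensors, and a morphism out of `T ⊗ M` is determined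
by its restrictions to the points of `T`. -/
theorem coend_hom_ext {G : EnrichedFunctor CGWH.{u} Cᵒᵖ CGWH.{u}}
    {F : EnrichedFunctor CGWH.{u} C N} {Z : N} {f g : coend G F ⟶ Z}
    (h : ∀ (c : C) (t : G.obj (op c)), tensorInj t (F.obj c) ≫ coendι G F c ≫ f =
      tensorInj t (F.obj c) ≫ coendι G F c ≫ g) : f = g := by
  refine coequalizer.hom_ext (Sigma.hom_ext _ _ fun c => ?_)
  have h' : coendι G F c ≫ f = coendι G F c ≫ g := tensor_hom_ext (h c)
  exact (Category.assoc _ _ _).symm.trans (h'.trans (Category.assoc _ _ _))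

/-- There is a morphism from the coend with prescribed values on points. -/
theorem exists_coend_desc (G : EnrichedFunctor CGWH.{u} Cᵒᵖ CGWH.{u})
    (F : EnrichedFunctor CGWH.{u} C N) {Z : N} (φ : ∀ c, G.obj (op c) ⟶ (F.obj c ⟶[CGWH.{u}] Z))
    (hφ : ∀ (c c' : C) (f : (c ⟶[CGWH.{u}] c' : CGWH.{u})) (g : G.obj (op c')),
      ofPt (φ c (presheafAct G f g)) = ofPt (F.map c c' f) ≫ ofPt (φ c' g)) :
    ∃ b : coend G F ⟶ Z, ∀ (c : C) (g : G.obj (op c)),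
      tensorInj g (F.obj c) ≫ coendι G F c ≫ b = ofPt (φ c g) := by
  refine ⟨coequalizer.desc (Sigma.desc fun c => tensorDesc (φ c)) (Sigma.hom_ext _ _ fun p => ?_),
    fun c g => ?_⟩
  · obtain ⟨c, c'⟩ := p
    have h : coendLeft G F c c' ≫ tensorDesc (φ c) = coendRight G F c c' ≫ tensorDesc (φ c') := by
      -- Tested at points `f` of `C(c, c')` and `g` of `G(c')`, the coequalizer condition becomes
      -- `hφ`.
      refine tensor_hom_ext fun f => tensor_hom_ext fun g => ?_
      have hl := congrArg (· ≫ tensorDesc (φ c)) (tensorInj_coendLeft G F f g)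
      have hr := congrArg (· ≫ tensorDesc (φ c')) (tensorInj_coendRight G F f g)
      simp only [Category.assoc, tensorInj_tensorDesc] at hl hr
      exact hl.trans ((hφ c c' f g).trans hr.symm)
    simpa [coendFst, coendSnd] using h
  · rw [← tensorInj_tensorDesc]
    congr 1
    exact (Category.assoc _ _ _).trans ((congrArg _ (coequalizer.π_desc _ _)).trans
      (Sigma.ι_desc _ _))

theorem tensorInj_coendι_coendMap {G G' : EnrichedFunctor CGWH.{u} Cᵒᵖ CGWH.{u}}
    {F F' : EnrichedFunctor CGWH.{u} C N} (η : G ⟶ G') (θ : F ⟶ F') (c : C) (g : G.obj (op c)) :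
    tensorInj g (F.obj c) ≫ coendι G F c ≫ coendMap η θ =
      app θ c ≫ tensorInj (app η (op c) g) (F'.obj c) ≫ coendι G' F' c := by
  rw [coendι_coendMap, ← Category.assoc, tensorInj_tensorMap, Category.assoc]

namespace Collage

variable (G : EnrichedFunctor CGWH.{u} Cᵒᵖ CGWH.{u}) (F F' : EnrichedFunctor CGWH.{u} C N)

/-- The extension of a functor to the collage of `G` on objects. -/
def extendObj : Collage G → N
  | of c => F.obj c
  | apex => coend G F

/-- The extension of a functor to the collage of `G` on hom-spaces. -/
def extendMap : ∀ X Y : Collage G, homSpace G X Y ⟶ (extendObj G F X ⟶[CGWH.{u}] extendObj G F Y)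
  | of c, of c' => F.map c c'
  -- The adjunct of the canonical morphism `G(c) ⊗ F(c) ⟶ ∫^C G ⊗ F`.
  | of c, apex => tensorUnit (G.obj (op c)) (F.obj c) ≫
      eHomWhiskerLeft CGWH.{u} (F.obj c) (coendι G F c)
  | apex, of _ => fromEmpty (fun x => x) _
  | apex, apex => eId CGWH.{u} (coend G F)

theorem ofPt_extendMap (c : C) (g : G.obj (op c)) :
    ofPt (extendMap G F (of c) apex g) = tensorInj g (F.obj c) ≫ coendι G F c :=
  ofPt_eHomWhiskerLeft _ _ _

/-- The extension of a functor to the collage of `G`, by the coend with `G`. -/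
def extend : EnrichedFunctor CGWH.{u} (Collage G) N where
  obj := extendObj G F
  map := extendMap G F
  map_id X := by
    rcases X with c | _
    · exact F.map_id c
    · rfl
  map_comp X Y Z := by
    refine CGWH.hom_ext fun p => ?_
    obtain ⟨f, g, rfl⟩ := CGWH.pair_surjective p
    rcases X with c | _ <;> rcases Y with d | _ <;> rcases Z with e | _ <;>
      try first
      | exact PEmpty.elim f
      | exact PEmpty.elim g
    · exact map_eComp F f g
    -- Functoriality on `c`, `d`, apex is exactly the relation imposed by the coend.
    · apply ofPt_injective
      refine (ofPt_extendMap G F c (presheafAct G f g)).trans ?_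
      refine Eq.trans ?_ (ofPt_eComp (F.map c d f) (extendMap G F (of d) apex g)).symm
      refine Eq.trans ?_ (congrArg (ofPt (F.map c d f) ≫ ·) (ofPt_extendMap G F d g)).symm
      exact coend_condition_apply G F f g
    · exact (eComp_eId_right (C := N) _).symm
    · exact (eComp_eId_right (C := N) _).symm

/-! ### Natural transformations out of the extension -/

variable {G F F'}

/-- The natural transformation from an extension to the collage with given components. -/
def extendHomMk {H : EnrichedFunctor CGWH.{u} (Collage G) N} (a : ∀ c, F.obj c ⟶ H.obj (of c))
    (b : coend G F ⟶ H.obj apex)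
    (ha : ∀ (c c' : C) (f : (c ⟶[CGWH.{u}] c' : CGWH.{u})),
      ofPt (F.map c c' f) ≫ a c' = a c ≫ ofPt (H.map (of c) (of c') f))
    (hb : ∀ (c : C) (g : G.obj (op c)),
      tensorInj g (F.obj c) ≫ coendι G F c ≫ b = a c ≫ ofPt (H.map (of c) apex g)) :
    extend G F ⟶ H :=
  natTransMk (fun X => match X with
      | of c => a c
      | apex => b) <| by
    rintro (c | _) (c' | _) f
    · exact ha c c' f
    · refine (congrArg (· ≫ b) (ofPt_extendMap G F c f)).trans ?_
      exact (Category.assoc _ _ _).trans (hb c f)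
    · exact PEmpty.elim f
    · refine (congrArg (· ≫ b) (ofPt_eId (coend G F))).trans ((Category.id_comp b).trans ?_)
      have h := congrArg ofPt (map_eId H apex)
      exact (Category.comp_id b).symm.trans (congrArg (b ≫ ·) (h.trans (ofPt_eId _)).symm)

section

variable {H : EnrichedFunctor CGWH.{u} (Collage G) N} (a : ∀ c, F.obj c ⟶ H.obj (of c))
    (b : coend G F ⟶ H.obj apex)
    (ha : ∀ (c c' : C) (f : (c ⟶[CGWH.{u}] c' : CGWH.{u})),
      ofPt (F.map c c' f) ≫ a c' = a c ≫ ofPt (H.map (of c) (of c') f))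
    (hb : ∀ (c : C) (g : G.obj (op c)),
      tensorInj g (F.obj c) ≫ coendι G F c ≫ b = a c ≫ ofPt (H.map (of c) apex g))

theorem app_extendHomMk_of (c : C) : app (extendHomMk a b ha hb) (of c) = a c :=
  app_natTransMk ..

theorem app_extendHomMk_apex : app (extendHomMk a b ha hb) apex = b :=
  app_natTransMk ..

end

/-- Naturality at the morphism from `c` to the apex given by `g`. It shows that the apex component
is determined by the components on `C`. -/
theorem tensorInj_coendι_app_apex {H : EnrichedFunctor CGWH.{u} (Collage G) N}
    (η : extend G F ⟶ H) (c : C) (g : G.obj (op c)) :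
    tensorInj g (F.obj c) ≫ coendι G F c ≫ app η apex =
      app η (of c) ≫ ofPt (H.map (of c) apex g) :=
  (Category.assoc _ _ _).symm.trans ((congrArg (· ≫ app η apex) (ofPt_extendMap G F c g)).symm.trans
    (naturality η (c := of c) (c' := apex) g))

theorem extend_hom_ext {H : EnrichedFunctor CGWH.{u} (Collage G) N} {η θ : extend G F ⟶ H}
    (h : ∀ c : C, app η (of c) = app θ (of c)) : η = θ := by
  refine natTrans_ext fun X => ?_
  rcases X with c | _
  · exact h c
  · refine coend_hom_ext fun c g => ?_
    exact (tensorInj_coendι_app_apex η c g).trans ((congrArg (· ≫ _) (h c)).trans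
      (tensorInj_coendι_app_apex θ c g).symm)

/-- The action of `H` on morphisms to the apex, precomposed with `a c`, gives maps `G(c) ⟶ N(F(c),
H(apex))`. They are compatible because `H` is a functor and `a` is natural, so they descend to the
coend and supply the apex component. -/
theorem exists_extend_hom {H : EnrichedFunctor CGWH.{u} (Collage G) N}
    (a : ∀ c, F.obj c ⟶ H.obj (of c))
    (ha : ∀ (c c' : C) (f : (c ⟶[CGWH.{u}] c' : CGWH.{u})),
      ofPt (F.map c c' f) ≫ a c' = a c ≫ ofPt (H.map (of c) (of c') f)) :
    ∃ η : extend G F ⟶ H, ∀ c, app η (of c) = a c := by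
  obtain ⟨b, hb⟩ := exists_coend_desc G F
    (fun c => H.map (of c) apex ≫ eHomWhiskerRight CGWH.{u} (a c) (H.obj apex)) fun c c' f g => by
      have h : H.map (of c) apex (presheafAct G f g) = eComp CGWH.{u} _ _ _
          (CGWH.pair (H.map (of c) (of c') f) (H.map (of c') apex g)) :=
        map_eComp H (c := of c) (c' := of c') (c'' := apex) f g
      refine (ofPt_eHomWhiskerRight (a c) _ _).trans ?_
      refine Eq.trans ?_ (congrArg (_ ≫ ·) (ofPt_eHomWhiskerRight (a c') _ _).symm)
      refine (congrArg (fun x => a c ≫ ofPt x) h).trans ?_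
      rw [ofPt_eComp, ← Category.assoc, ← ha, Category.assoc]
      rfl
  exact ⟨extendHomMk a b ha fun c g => (hb c g).trans (ofPt_eHomWhiskerRight _ _ _),
    app_extendHomMk_of a b ha _⟩

/-! ### The adjunction between extension and restriction -/

variable (G) in
/-- The functoriality of the extension to the collage. -/
def extendMapHom (θ : F ⟶ F') : extend G F ⟶ extend G F' :=
  extendHomMk (H := extend G F') (app θ) (coendMap (𝟙 G) θ)
    (fun _ _ f => naturality θ f) fun c g => by
      refine Eq.trans ?_ (congrArg (app θ c ≫ ·) (ofPt_extendMap G F' c g)).symm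
      refine (tensorInj_coendι_coendMap (𝟙 G) θ c g).trans ?_
      rw [app_id]
      rfl

theorem app_extendMapHom_apex (θ : F ⟶ F') : app (extendMapHom G θ) apex = coendMap (𝟙 G) θ :=
  app_extendHomMk_apex (H := extend G F') ..

theorem app_extendMapHom_of (θ : F ⟶ F') (c : C) : app (extendMapHom G θ) (of c) = app θ c :=
  app_extendHomMk_of (H := extend G F') ..

variable (G N) in
/-- The extension to the collage as a functor. -/
def extendFunctor : EnrichedFunctor CGWH.{u} C N ⥤ EnrichedFunctor CGWH.{u} (Collage G) N where
  obj := extend G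
  map := extendMapHom G
  map_id F := extend_hom_ext fun c => (app_extendMapHom_of (𝟙 F) c).trans
    ((app_id F c).trans (app_id (extend G F) (of c)).symm)
  map_comp θ θ' := extend_hom_ext fun c => (app_extendMapHom_of (θ ≫ θ') c).trans
    ((app_comp θ θ' c).trans ((app_comp _ _ _).trans
      (congrArg₂ (· ≫ ·) (app_extendMapHom_of θ c) (app_extendMapHom_of θ' c))).symm)

/-- The restriction to `C` of a natural transformation from an extension. -/
def restrictHom {H : EnrichedFunctor CGWH.{u} (Collage G) N} (η : extend G F ⟶ H) :
    F ⟶ (restriction (incl G) N).obj H :=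
  natTransMk (F' := (restriction (incl G) N).obj H)
    (fun c => app η (of c)) fun c c' f => naturality η (c := of c) (c' := of c') f

theorem app_restrictHom {H : EnrichedFunctor CGWH.{u} (Collage G) N} (η : extend G F ⟶ H)
    (c : C) : app (restrictHom η) c = app η (of c) :=
  app_natTransMk (F' := (restriction (incl G) N).obj H) ..

/-- The universal property of the left Kan extension along `incl G`: uniqueness is `extend_hom_ext`,
existence is `exists_extend_hom`. -/
theorem restrictHom_bijective (F : EnrichedFunctor CGWH.{u} C N)
    (H : EnrichedFunctor CGWH.{u} (Collage G) N) :
    Function.Bijective (restrictHom : (extend G F ⟶ H) → _) := by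
  refine ⟨fun η θ h => extend_hom_ext fun c => ?_, fun θ => ?_⟩
  · rw [← app_restrictHom, h, app_restrictHom]
  · obtain ⟨η, hη⟩ := exists_extend_hom (H := H) (app θ) fun c c' f => naturality θ f
    exact ⟨η, natTrans_ext fun c => (app_restrictHom η c).trans (hη c)⟩

theorem restrictHom_extendMapHom_comp {H : EnrichedFunctor CGWH.{u} (Collage G) N} (θ : F ⟶ F')
    (η : extend G F' ⟶ H) : restrictHom (extendMapHom G θ ≫ η) = θ ≫ restrictHom η := by
  refine natTrans_ext fun c => (app_restrictHom _ c).trans ((app_comp _ _ _).trans ?_)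
  refine Eq.trans ?_ (app_comp θ (restrictHom η) c).symm
  exact congrArg₂ (· ≫ ·) (app_extendMapHom_of θ c) (app_restrictHom η c).symm

theorem restrictHom_comp {H H' : EnrichedFunctor CGWH.{u} (Collage G) N} (η : extend G F ⟶ H)
    (θ : H ⟶ H') : restrictHom (η ≫ θ) = restrictHom η ≫ (restriction (incl G) N).map θ := by
  refine natTrans_ext fun c => (app_restrictHom _ c).trans ((app_comp _ _ _).trans ?_)
  refine Eq.trans ?_ (app_comp (restrictHom η) ((restriction (incl G) N).map θ) c).symm
  exact congrArg (· ≫ app θ (of c)) (app_restrictHom η c).symm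

variable (G N) in
/-- Extension to the collage is left adjoint to restriction along the inclusion. -/
def extendAdjunction : extendFunctor N G ⊣ restriction (incl G) N :=
  Adjunction.mkOfHomEquiv
    { homEquiv := fun F H => Equiv.ofBijective _ (restrictHom_bijective F H)
      homEquiv_naturality_left_symm := fun {F F' H} θ g => by
        -- Naturality of the inverse bijection follows from that of `restrictHom` once `g` is
        -- written as a restriction.
        obtain ⟨η, rfl⟩ := (restrictHom_bijective F' H).2 g
        refine (Equiv.symm_apply_eq _).2 ?_
        refine (restrictHom_extendMapHom_comp θ η).symm.trans ?_
        exact congrArg (fun x => restrictHom (extendMapHom G θ ≫ x))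
          (Equiv.ofBijective_symm_apply_apply _ (restrictHom_bijective F' H) η).symm
      homEquiv_naturality_right := fun η θ => restrictHom_comp η θ }

/-! ### Change of the presheaf -/

variable {G' : EnrichedFunctor CGWH.{u} Cᵒᵖ CGWH.{u}} (η : G ⟶ G') (F)

/-- The comparison of extensions to the collages of two presheaves. -/
def extendComparison : extend G F ⟶ (restriction (map η) N).obj (extend G' F) :=
  extendHomMk (H := (restriction (map η) N).obj (extend G' F)) (fun c => 𝟙 (F.obj c))
    (coendMap η (𝟙 F))
    (fun c c' f => (Category.comp_id _).trans (Category.id_comp _).symm) fun c g => by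
      refine Eq.trans ?_ (Category.id_comp _).symm
      refine Eq.trans ?_ (ofPt_extendMap G' F c (app η (op c) g)).symm
      refine (tensorInj_coendι_coendMap η (𝟙 F) c g).trans ?_
      rw [app_id, Category.id_comp]

theorem app_extendComparison_apex : app (extendComparison F η) apex = coendMap η (𝟙 F) :=
  app_extendHomMk_apex ..

theorem app_extendComparison_of (c : C) :
    app (extendComparison F η) (of c) = 𝟙 (F.obj c) :=
  app_extendHomMk_of ..

/-- Since `map η` is the identity on `C`, transformations from `extend G F` to the restriction of
`Z` and from `extend G' F` to `Z` both correspond to transformations from `F` to `Z` restricted to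
`C`. The comparison is the identity on `C`, so composing with it respects this correspondence. -/
theorem extendComparison_universal (Z : EnrichedFunctor CGWH.{u} (Collage G') N)
    (g : extend G F ⟶ (restriction (map η) N).obj Z) :
    ∃! h : extend G' F ⟶ Z, extendComparison F η ≫ (restriction (map η) N).map h = g := by
  have key : ∀ (h : extend G' F ⟶ Z) (c : C),
      app (extendComparison F η ≫ (restriction (map η) N).map h) (of c) = app h (of c) :=
    fun h c => by
      rw [app_comp, app_extendComparison_of]
      exact Category.id_comp _
  obtain ⟨h, hh⟩ := exists_extend_hom (G := G') (F := F) (H := Z) (fun c => app g (of c))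
    fun c c' f => naturality g (c := of c) (c' := of c') f
  refine ⟨h, extend_hom_ext fun c => (key h c).trans (hh c), fun h' e => ?_⟩
  refine extend_hom_ext fun c => (key h' c).symm.trans (Eq.trans ?_ (hh c).symm)
  rw [e]

end Collage

end extension

end

end TopEnriched

namespace TopEnriched

/-! ### Homotopy invariance of coends -/

section invariance

variable {C : Type u} [EnrichedCategory CGWH.{u} C]
  {N : Type v} [Category.{w} N] [EnrichedOrdinaryCategory CGWH.{u} N] [ModelCategory N]

/-- Cofibrancy does not depend on the choice of a projective model structure. -/
theorem isCofibrant_of_isProjectivelyCofibrant {F : EnrichedFunctor CGWH.{u} C N}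
    (hF : IsProjectivelyCofibrant F) (m : ModelCategory (EnrichedFunctor CGWH.{u} C N))
    (hm : IsProjective m) : IsCofibrant F := by
  revert m
  obtain ⟨m', hm', hF'⟩ := hF
  -- This lifting property refers only to the category, and the trivial fibrations of `m` and `m'`
  -- coincide, being the pointwise ones in both.
  have lift : ∀ {X Y : EnrichedFunctor CGWH.{u} C N} (p : X ⟶ Y), Fibration p →
      WeakEquivalence p → HasLiftingProperty (initial.to F) p := fun p _ _ => by
    have := (isCofibrant_iff F).1 hF'
    infer_instance
  intro m hm
  rw [isCofibrant_iff, cofibration_iff, ← trivialFibrations_llp]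
  intro X Y p hp
  obtain ⟨h₁, h₂⟩ := (mem_trivialFibrations_iff p).1 hp
  exact lift p ((hm'.fibration_iff p).2 ((hm.fibration_iff p).1 h₁))
    ((hm'.weakEquivalence_iff p).2 ((hm.weakEquivalence_iff p).1 h₂))

/-- Restriction merely reindexes components. With `weakEquivalence_restriction` it follows that
every restriction functor is right Quillen and preserves all weak equivalences. -/
theorem fibration_restriction {D : Type*} [EnrichedCategory CGWH.{u} D]
    (α : EnrichedFunctor CGWH.{u} C D) {mC : ModelCategory (EnrichedFunctor CGWH.{u} C N)}
    {mD : ModelCategory (EnrichedFunctor CGWH.{u} D N)} (hC : IsProjective mC)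
    (hD : IsProjective mD) {X Y : EnrichedFunctor CGWH.{u} D N} (f : X ⟶ Y) (hf : Fibration f) :
    Fibration ((restriction α N).map f) :=
  (hC.fibration_iff _).2 fun c => (hD.fibration_iff f).1 hf (α.obj c)

theorem weakEquivalence_restriction {D : Type*} [EnrichedCategory CGWH.{u} D]
    (α : EnrichedFunctor CGWH.{u} C D) {mC : ModelCategory (EnrichedFunctor CGWH.{u} C N)}
    {mD : ModelCategory (EnrichedFunctor CGWH.{u} D N)} (hC : IsProjective mC)
    (hD : IsProjective mD) {X Y : EnrichedFunctor CGWH.{u} D N} (f : X ⟶ Y)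
    (hf : WeakEquivalence f) : WeakEquivalence ((restriction α N).map f) :=
  (hC.weakEquivalence_iff _).2 fun c => (hD.weakEquivalence_iff f).1 hf (α.obj c)

variable [IsTopBicomplete.{u} N]

/-- The map of coends is the apex component of the image of `θ` under the left Quillen functor
`extendFunctor`. -/
theorem weakEquivalence_coendMap_right (hN : IsGood.{u} N)
    (G : EnrichedFunctor CGWH.{u} Cᵒᵖ CGWH.{u}) {F F' : EnrichedFunctor CGWH.{u} C N} (θ : F ⟶ F')
    (hF : IsProjectivelyCofibrant F) (hF' : IsProjectivelyCofibrant F')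
    (hθ : ∀ c, WeakEquivalence (app θ c)) : WeakEquivalence (coendMap (𝟙 G) θ) := by
  obtain ⟨mC, hC⟩ := hN.exists_isProjective C
  obtain ⟨mD, hD⟩ := hN.exists_isProjective (Collage G)
  have := isCofibrant_of_isProjectivelyCofibrant hF mC hC
  have := isCofibrant_of_isProjectivelyCofibrant hF' mC hC
  have : WeakEquivalence θ := (hC.weakEquivalence_iff θ).2 hθ
  have h : WeakEquivalence ((Collage.extendFunctor N G).map θ) :=
    weakEquivalence_map_of_isCofibrant (Collage.extendAdjunction N G)
      (fun _ _ f hf => fibration_restriction _ hC hD f hf) θ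
  have h' := (hD.weakEquivalence_iff _).1 h Collage.apex
  rwa [← Collage.app_extendMapHom_apex]

/-- The map of coends is the apex component of the universal arrow `extendComparison F η`, whose
source is cofibrant because extension is left Quillen. -/
theorem weakEquivalence_coendMap_left (hN : IsGood.{u} N)
    {G G' : EnrichedFunctor CGWH.{u} Cᵒᵖ CGWH.{u}} (η : G ⟶ G')
    (hη : ∀ c, CGWH.IsWeakEquivalence (app η c)) {F : EnrichedFunctor CGWH.{u} C N}
    (hF : IsProjectivelyCofibrant F) : WeakEquivalence (coendMap η (𝟙 F)) := by
  obtain ⟨mC, hC⟩ := hN.exists_isProjective C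
  obtain ⟨mD, hD⟩ := hN.exists_isProjective (Collage G)
  obtain ⟨mD', hD'⟩ := hN.exists_isProjective (Collage G')
  have := isCofibrant_of_isProjectivelyCofibrant hF mC hC
  have : IsCofibrant (Collage.extend G F) :=
    isCofibrant_obj_of_adjunction (Collage.extendAdjunction N G)
      (fun _ _ f hf hf' => ⟨fibration_restriction _ hC hD f hf,
        weakEquivalence_restriction _ hC hD f hf'⟩) F
  have h : WeakEquivalence (Collage.extendComparison F η) :=
    weakEquivalence_of_universal
      (hN.isRightQuillenEquivalence (Collage.map η) (Collage.mapObj_bijective G G')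
        (Collage.isWeakEquivalence_map η hη) mD mD' hD hD')
      (fun _ _ f hf => weakEquivalence_restriction _ hD hD' f hf)
      (Collage.extendComparison F η) (Collage.extendComparison_universal F η)
  have h' := (hD.weakEquivalence_iff _).1 h Collage.apex
  have e := Collage.app_extendComparison_apex F η
  rwa [e] at h'

end invariance

end TopEnriched

theorem mainTheorem3 (N : Type v) [Category.{w} N] [EnrichedOrdinaryCategory CGWH.{u} N]
    [ModelCategory N] [IsTopologicalModelCategory.{u} N] (hN : IsGood.{u} N)
    (C : Type u) [EnrichedCategory CGWH.{u} C] :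
    (∀ F : EnrichedFunctor CGWH.{u} C N, IsProjectivelyCofibrant F →
      ∀ (G G' : EnrichedFunctor CGWH.{u} Cᵒᵖ CGWH.{u}) (η : G ⟶ G'),
        (∀ c, CGWH.IsWeakEquivalence (app η c)) → WeakEquivalence (coendMap η (𝟙 F))) ∧
    (∀ (G : EnrichedFunctor CGWH.{u} Cᵒᵖ CGWH.{u}) (F F' : EnrichedFunctor CGWH.{u} C N)
      (θ : F ⟶ F'), IsProjectivelyCofibrant F → IsProjectivelyCofibrant F' →
        (∀ c, WeakEquivalence (app θ c)) → WeakEquivalence (coendMap (𝟙 G) θ)) := by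
  exact ⟨fun _ hF _ _ η hη => weakEquivalence_coendMap_left hN η hη hF,
    fun G _ _ θ hF hF' hθ => weakEquivalence_coendMap_right hN G θ hF hF' hθ⟩
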